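/- Let $p\ge 1$ and $0\le q\le p$. Let $\mathbb Z/2=\{1,g\}$ act on $\mathbb R^{p,q}=\mathbb R^p$ through the diagonal matrix $I_{p,q}=\mathrm{diag}(1,\dots,1,-1,\dots,-1)$ with $q$ entries $-1$, and let $SO(p,q)$ be the rotation group $SO(p)$ with the action $g\cdot A=I_{p,q}AI_{p,q}$. For a line $\ell$ in $\mathbb R^{p}$ put $\omega(\ell)=r(\ell)r(e_1)$, where $r(\ell)$ is the reflection across the hyperplane orthogonal to $\ell$ and $r(e_1)$ is that for the line spanned by $e_1=(1,0,\dots,0)$. Let $0=V_0\subset V_1\subset\dots\subset V_p=\mathbb R^{p,q}$ be a flag of $\mathbb Z/2$-stable subspaces with $\dim V_i=i$ and $V_1=\mathbb R e_1$ (for example the standard flag). For $0\le i<p$ let $P^i=\mathbb P(V_{i+1})$ be the space of lines in $V_{i+1}$, with the inherited action, let $f_i$ be a unit vector in $V_{i+1}$ orthogonal to $V_i$, and let $\varphi^i\colon D^i\to P^i$ be the map from the unit disc of $\mathbb R^i$ that sends $x$ to the line spanned by $x_1f_0+\dots+x_if_{i-1}+\sqrt{1-|x|^2}\,f_i$; it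 is equivariant if $g$ acts on $\mathbb R^i$ by multiplying the $k$-th coordinate by $\varepsilon_{k-1}\varepsilon_i$, where $g f_k=\varepsilon_k f_k$. For a sequence $I=(i_1,\dots,i_m)$ of integers $0\le i_j<p$ let $P^I=P^{i_1}\times\dots\times P^{i_m}$ with the diagonal action, $D^I=D^{i_1}\times\dots\times D^{i_m}$, $\varphi^I=\varphi^{i_1}\times\dots\times\varphi^{i_m}\colon D^I\to P^I$, and $\omega\colon P^I\to SO(p,q)$, $\omega(\ell_1,\dots,\ell_m)=\omega(\ell_1)\cdots\omega(\ell_m)$. Rescaling along rays identifies $D^I$ equivariantly with the unit disc of the representation $\mathbb R^{i_1}\oplus\dots\oplus\mathbb R^{i_m}$. Call $I$ admissible if $I=(0)$, or $m\ge1$ and $p>i_1>\dots>i_m>0$. A $\mathrm{Rep}(\mathbb Z/2)$-complex structure on a $\mathbb Z/2$-space $X$ is a filtration $X^{(0)}\subset X^{(1)}\subset\cdots$ with union $X$, with the colimit topology, such that $X^{(0)}$ is a discrete disjoint union of orbits and $X^{(n)}$ is obtained from $X^{(n-1)}$ by attaching discs $D(V)$ of $n$-dimensional orthogonal representations $V$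 along equivariant maps $S(V)\to X^{(n-1)}$. Then the maps $\omega\varphi^I\colon D^I\to SO(p,q)$, with $I$ ranging over all admissible sequences, are the characteristic maps of a $\mathrm{Rep}(\mathbb Z/2)$-complex structure on $SO(p,q)$. The products of the maps $\varphi^{j_k}\colon D^{j_k}\to P^{j_k}\subset P^{p-k}$, with $0\le j_k\le p-k$ for $1\le k\le p-1$, are the characteristic maps of a $\mathrm{Rep}(\mathbb Z/2)$-complex structure on $P^{p-1}\times P^{p-2}\times\dots\times P^1$ (a point if $p=1$), and for these two structures the equivariant map $\omega\colon P^{p-1}\times\dots\times P^1\to SO(p,q)$ is cellular. -/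

import Mathlib

open Set Metric Topology

open scoped LinearAlgebra.Projectivization

noncomputable section

/-! ### `Rep(G)`-complexes -/

namespace RepCell

/-- The unit disc `D(V)` of a real inner product space. -/
abbrev Disc (V : Type*) [NormedAddCommGroup V] : Type _ := closedBall (0 : V) 1

/-- The action of `g` on the unit disc `D(V)` of an orthogonal representation `ρ` of `G` on `V`. -/
def discAct {G V : Type*} [Group G] [NormedAddCommGroup V] [InnerProductSpace ℝ V]
    (ρ : G →* (V ≃ₗᵢ[ℝ] V)) (g : G) (x : Disc V) : Disc V :=
  ⟨ρ g x, mem_closedBall_zero_iff.2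
    (((ρ g).norm_map x).trans_le (mem_closedBall_zero_iff.1 x.2))⟩

/-- The canonical map from the disjoint union of `A` and of the discs `D(V i)`, for all `i`
with `dim (V i) = n`, to `X`. -/
def attachMap {X ι : Type*} {V : ι → Type*} [∀ i, NormedAddCommGroup (V i)]
    [∀ i, InnerProductSpace ℝ (V i)] (Φ : ∀ i, Disc (V i) → X) (A : Set X) (n : ℕ) :
    (A ⊕ (Σ i : {i : ι // Module.finrank ℝ (V i) = n}, Disc (V i))) → X :=
  Sum.elim Subtype.val (fun z => Φ z.1 z.2)

/-- `IsRepComplex ρ Φ sk` : the filtration `sk 0 ⊆ sk 1 ⊆ ⋯` of the `G`-space `X`, together with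
the cells of positive dimension with representations `ρ i : G → O(V i)` and
characteristic maps `Φ i : D(V i) → X`, is a `Rep(G)`-complex structure on `X`.

The fields `quotient`, `interior_notMem` and `interior_inj` say that the canonical
map to `sk (n + 1)` from the space that is obtained by gluing the discs `D(V i)` with
`dim (V i) = n + 1` to `sk n` along the maps `Φ i : S(V i) → sk n` is a homeomorphism. -/
structure IsRepComplex {G X ι : Type*} [Group G] [TopologicalSpace X] [MulAction G X]
    [ContinuousConstSMul G X] {V : ι → Type*} [∀ i, NormedAddCommGroup (V i)]
    [∀ i, InnerProductSpace ℝ (V i)] [∀ i, FiniteDimensional ℝ (V i)]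
    (ρ : ∀ i, G →* (V i ≃ₗᵢ[ℝ] V i)) (Φ : ∀ i, Disc (V i) → X) (sk : ℕ → Set X) : Prop where
  /-- `X⁽⁰⁾` is a disjoint union of `G`-orbits, i.e. a discrete `G`-stable set. -/
  discrete_zero : DiscreteTopology (sk 0)
  smul_mem_zero : ∀ (g : G), ∀ x ∈ sk 0, g • x ∈ sk 0
  dim_pos : ∀ i, 0 < Module.finrank ℝ (V i)
  /-- The characteristic maps, hence also the attaching maps, are `G`-maps. -/
  equivariant : ∀ i (g : G) (x : Disc (V i)), Φ i (discAct (ρ i) g x) = g • Φ i x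
  subset_succ : ∀ n, sk n ⊆ sk (n + 1)
  /-- The attaching map of an `(n + 1)`-cell goes from the unit sphere to the `n`-skeleton. -/
  sphere_mem : ∀ i n, Module.finrank ℝ (V i) = n + 1 →
    ∀ x : Disc (V i), ‖(x : V i)‖ = 1 → Φ i x ∈ sk n
  /-- `X⁽ⁿ⁺¹⁾` is the quotient space of the disjoint union of `X⁽ⁿ⁾` and the discs. -/
  quotient : ∀ n, ∃ h : ∀ z, attachMap Φ (sk n) (n + 1) z ∈ sk (n + 1),
    IsQuotientMap (Set.codRestrict (attachMap Φ (sk n) (n + 1)) (sk (n + 1)) h)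
  interior_notMem : ∀ i n, Module.finrank ℝ (V i) = n + 1 →
    ∀ x : Disc (V i), ‖(x : V i)‖ < 1 → Φ i x ∉ sk n
  interior_inj : ∀ i j, Module.finrank ℝ (V i) = Module.finrank ℝ (V j) →
    ∀ (x : Disc (V i)) (y : Disc (V j)), ‖(x : V i)‖ < 1 → ‖(y : V j)‖ < 1 → Φ i x = Φ j y →
      (⟨i, x⟩ : Σ i, Disc (V i)) = ⟨j, y⟩
  iUnion_eq : ⋃ n, sk n = univ
  /-- `X` has the colimit topology of the filtration. -/
  closed_of : ∀ A : Set X, (∀ n, IsClosed ((↑) ⁻¹' A : Set (sk n))) → IsClosed A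

/-- `AreCharMaps ρ Φ sk` : the maps `Φ i : D(V i) → X` (dimension zero allowed) are the
characteristic maps of a `Rep(G)`-complex structure on `X` with skeleta `sk`: the `0`-skeleton
consists of distinct fixed points, one for each `i` with `dim (V i) = 0`, and the `Φ i` with
`dim (V i) > 0` are the characteristic maps of the cells of positive dimension. -/
structure AreCharMaps {G X ι : Type*} [Group G] [TopologicalSpace X] [MulAction G X]
    [ContinuousConstSMul G X] {V : ι → Type*} [∀ i, NormedAddCommGroup (V i)]
    [∀ i, InnerProductSpace ℝ (V i)] [∀ i, FiniteDimensional ℝ (V i)]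
    (ρ : ∀ i, G →* (V i ≃ₗᵢ[ℝ] V i)) (Φ : ∀ i, Disc (V i) → X) (sk : ℕ → Set X) : Prop where
  isRepComplex : IsRepComplex (ι := {i : ι // 0 < Module.finrank ℝ (V i)})
    (fun i => ρ i) (fun i => Φ i) sk
  equivariant_zero : ∀ i, Module.finrank ℝ (V i) = 0 →
    ∀ (g : G) (x : Disc (V i)), Φ i (discAct (ρ i) g x) = g • Φ i x
  zero_mem : ∀ i, Module.finrank ℝ (V i) = 0 → ∀ x, Φ i x ∈ sk 0
  zero_unique : ∀ x ∈ sk 0, ∃! i, Module.finrank ℝ (V i) = 0 ∧ x ∈ range (Φ i)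

/-- Cellular `G`-maps between `G`-spaces with filtrations by skeleta. -/
structure IsCellular (G : Type*) {X Y : Type*} [Group G] [TopologicalSpace X] [MulAction G X]
    [TopologicalSpace Y] [MulAction G Y] (skX : ℕ → Set X) (skY : ℕ → Set Y) (f : X → Y) :
    Prop where
  continuous : Continuous f
  equivariant : ∀ (g : G) (x : X), f (g • x) = g • f x
  mapsTo : ∀ n, MapsTo f (skX n) (skY n)

/-- A linear homeomorphism between normed spaces `E` and `F`, rescaled along rays, is a
homeomorphism from the unit disc of `E` to the unit disc of `F`. -/
def radialHomeo {E F : Type*} [NormedAddCommGroup E] [NormedSpace ℝ E] [FiniteDimensional ℝ E]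
    [NormedAddCommGroup F] [NormedSpace ℝ F] (L : E ≃L[ℝ] F) :
    closedBall (0 : E) 1 ≃ₜ closedBall (0 : F) 1 := by
  have hL : ∀ x : E, x ≠ 0 → ‖L x‖ ≠ 0 := fun x hx => by simpa using hx
  have hS : ∀ y : F, y ≠ 0 → ‖L.symm y‖ ≠ 0 := fun x hx => by simpa using hx
  have key : ∀ x : E, ‖(‖x‖ / ‖L x‖) • L x‖ = ‖x‖ := by
    intro x
    by_cases hx : x = 0
    · simp [hx]
    · rw [norm_smul, norm_div, norm_norm, norm_norm, div_mul_cancel₀ _ (hL x hx)]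
  have key' : ∀ y : F, ‖(‖y‖ / ‖L.symm y‖) • L.symm y‖ = ‖y‖ := by
    intro y
    by_cases hy : y = 0
    · simp [hy]
    · rw [norm_smul, norm_div, norm_norm, norm_norm, div_mul_cancel₀ _ (hS y hy)]
  let e : closedBall (0 : E) 1 ≃ closedBall (0 : F) 1 :=
    { toFun := fun x => ⟨(‖(x : E)‖ / ‖L x‖) • L x, by
        rw [mem_closedBall_zero_iff, key]; exact mem_closedBall_zero_iff.1 x.2⟩
      invFun := fun y => ⟨(‖(y : F)‖ / ‖L.symm y‖) • L.symm y, by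
        rw [mem_closedBall_zero_iff, key']; exact mem_closedBall_zero_iff.1 y.2⟩
      left_inv := by
        rintro ⟨x, hx⟩
        ext1
        by_cases h0 : x = 0
        · simp [h0]
        · have h1 := hL x h0
          have h2 : ‖x‖ ≠ 0 := by simpa using h0
          simp only [key, map_smul, L.symm_apply_apply, norm_smul, norm_div, norm_norm, smul_smul]
          rw [show ‖x‖ / (‖x‖ / ‖L x‖ * ‖x‖) * (‖x‖ / ‖L x‖) = 1 by field_simp, one_smul]
      right_inv := by
        rintro ⟨y, hy⟩
        ext1
        by_cases h0 : y = 0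
        · simp [h0]
        · have h1 := hS y h0
          have h2 : ‖y‖ ≠ 0 := by simpa using h0
          simp only [key', map_smul, L.apply_symm_apply, norm_smul, norm_div, norm_norm, smul_smul]
          rw [show ‖y‖ / (‖y‖ / ‖L.symm y‖ * ‖y‖) * (‖y‖ / ‖L.symm y‖) = 1 by field_simp,
            one_smul] }
  have he : Continuous e := by
    refine Continuous.subtype_mk ?_ _
    suffices h : Continuous fun x : E => (‖x‖ / ‖L x‖) • L x from h.comp continuous_subtype_val
    rw [continuous_iff_continuousAt]
    intro x
    by_cases h0 : x = 0
    · subst h0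
      rw [ContinuousAt, map_zero, smul_zero, tendsto_zero_iff_norm_tendsto_zero]
      simp only [key]
      exact tendsto_norm_zero
    · exact ((continuous_norm.continuousAt).div (L.continuous.norm.continuousAt)
        (hL x h0)).smul L.continuous.continuousAt
  haveI : CompactSpace (closedBall (0 : E) 1) :=
    isCompact_iff_compactSpace.1 (isCompact_closedBall _ _)
  exact he.homeoOfEquivCompactToT2 (f := e)

end RepCell

/-! ### The `ℤ/2`-space `SO(p,q)`

The group `ℤ/2` is written multiplicatively as `ℤˣ = {1, -1}`, with generator `g = -1`. -/

namespace Rot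

open RepCell

/-- The orthogonal representation of `ℤ/2` on `ℝᵏ` where `u` multiplies the coordinate `a` by the
sign `χ a u`. -/
def signRep {κ : Type*} [Fintype κ] (χ : κ → (ℤˣ →* ℤˣ)) :
    ℤˣ →* (EuclideanSpace ℝ κ ≃ₗᵢ[ℝ] EuclideanSpace ℝ κ) where
  toFun u :=
    { toFun := fun x => WithLp.toLp 2 fun a => ((χ a u : ℤ) : ℝ) * x a
      invFun := fun x => WithLp.toLp 2 fun a => ((χ a u : ℤ) : ℝ) * x a
      map_add' := fun x y => by ext a; simp [mul_add]
      map_smul' := fun c x => by ext a; simp; ring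
      left_inv := fun x => by
        ext a
        rcases Int.units_eq_one_or (χ a u) with h | h <;> simp [h]
      right_inv := fun x => by
        ext a
        rcases Int.units_eq_one_or (χ a u) with h | h <;> simp [h]
      norm_map' := fun x => by
        simp only [EuclideanSpace.norm_eq]
        congr 1
        refine Finset.sum_congr rfl fun a _ => ?_
        rcases Int.units_eq_one_or (χ a u) with h | h <;> simp [h] }
  map_one' := by ext x a; simp
  map_mul' u v := by ext x a; simp [mul_assoc]

/-- The sign by which `ℤ/2` acts on the coordinate `a` of `ℝ^{p,q}`: trivial on the first `p - q`
coordinates and nontrivial on the last `q` coordinates. -/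
def coordSign (p q : ℕ) (a : Fin p) : ℤˣ →* ℤˣ :=
  if (a : ℕ) < p - q then 1 else MonoidHom.id ℤˣ

/-- The representation `ℝ^{p,q}`. -/
def stdRep (p q : ℕ) :
    ℤˣ →* (EuclideanSpace ℝ (Fin p) ≃ₗᵢ[ℝ] EuclideanSpace ℝ (Fin p)) :=
  signRep (coordSign p q)

/-- The matrix `I_{p,q}`. -/
def Ipq (p q : ℕ) : Matrix (Fin p) (Fin p) ℝ :=
  Matrix.diagonal fun a => if (a : ℕ) < p - q then 1 else -1

theorem Ipq_mul_self (p q : ℕ) : Ipq p q * Ipq p q = 1 := by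
  rw [Ipq, Matrix.diagonal_mul_diagonal, ← Matrix.diagonal_one]
  congr 1
  ext a
  split_ifs <;> norm_num

theorem Ipq_transpose (p q : ℕ) : (Ipq p q).transpose = Ipq p q :=
  Matrix.diagonal_transpose _

/-- The space underlying `SO(p,q)`: the group of rotations of `ℝᵖ`. -/
def SO (p _q : ℕ) : Type := Matrix.specialOrthogonalGroup (Fin p) ℝ

variable {p q : ℕ}

instance : Group (SO p q) := inferInstanceAs (Group (Matrix.specialOrthogonalGroup (Fin p) ℝ))

instance : TopologicalSpace (SO p q) :=
  inferInstanceAs (TopologicalSpace (Matrix.specialOrthogonalGroup (Fin p) ℝ))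

/-- The matrix of a rotation. -/
def SO.mat (A : SO p q) : Matrix (Fin p) (Fin p) ℝ := Subtype.val A

theorem SO.mat_injective : Function.Injective (SO.mat (p := p) (q := q)) := Subtype.val_injective

/-- The rotation with a given matrix. -/
def SO.mk (A : Matrix (Fin p) (Fin p) ℝ) (h : A * A.transpose = 1) (hdet : A.det = 1) : SO p q :=
  ⟨A, Matrix.mem_specialOrthogonalGroup_iff.2
    ⟨(Matrix.mem_orthogonalGroup_iff _ _).2 h, hdet⟩⟩

theorem SO.mat_mul_transpose (A : SO p q) : A.mat * A.mat.transpose = 1 :=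
  (Matrix.mem_orthogonalGroup_iff _ _).1 (Matrix.mem_specialOrthogonalGroup_iff.1 A.2).1

theorem SO.det_mat (A : SO p q) : A.mat.det = 1 :=
  (Matrix.mem_specialOrthogonalGroup_iff.1 A.2).2

theorem SO.mul_mat (A B : SO p q) : (A * B).mat = A.mat * B.mat := rfl

theorem SO.continuous_mat : Continuous (SO.mat (p := p) (q := q)) := continuous_subtype_val

/-- `g · A = I_{p,q} A I_{p,q}`. -/
def SO.conj (A : SO p q) : SO p q :=
  SO.mk (Ipq p q * A.mat * Ipq p q)
    (by
      have h := A.mat_mul_transpose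
      have h2 := Ipq_mul_self p q
      rw [Matrix.transpose_mul, Matrix.transpose_mul, Ipq_transpose]
      calc _ = Ipq p q * A.mat * (Ipq p q * Ipq p q) * A.mat.transpose * Ipq p q := by
            simp only [Matrix.mul_assoc]
        _ = Ipq p q * (A.mat * A.mat.transpose) * Ipq p q := by
            rw [h2, Matrix.mul_one, Matrix.mul_assoc (Ipq p q)]
        _ = 1 := by rw [h, Matrix.mul_one, h2])
    (by
      have h2 := congrArg Matrix.det (Ipq_mul_self p q)
      rw [Matrix.det_mul, Matrix.det_one] at h2
      rw [Matrix.det_mul, Matrix.det_mul, A.det_mat, mul_one, h2])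

theorem SO.conj_conj (A : SO p q) : A.conj.conj = A := by
  apply SO.mat_injective
  change Ipq p q * (Ipq p q * A.mat * Ipq p q) * Ipq p q = A.mat
  have h2 := Ipq_mul_self p q
  calc _ = (Ipq p q * Ipq p q) * A.mat * (Ipq p q * Ipq p q) := by simp only [Matrix.mul_assoc]
    _ = A.mat := by rw [h2, Matrix.one_mul, Matrix.mul_one]

/-- The action of `ℤ/2` on `SO(p,q)`, for which the generator acts by `A ↦ I_{p,q} A I_{p,q}`. -/
instance : MulAction ℤˣ (SO p q) where
  smul u A := if u = 1 then A else A.conj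
  one_smul A := if_pos rfl
  mul_smul u v A := by
    change (if u * v = 1 then A else A.conj) =
      if u = 1 then (if v = 1 then A else A.conj) else (if v = 1 then A else A.conj).conj
    rcases Int.units_eq_one_or u with rfl | rfl <;> rcases Int.units_eq_one_or v with rfl | rfl <;>
      simp [SO.conj_conj]

instance : ContinuousConstSMul ℤˣ (SO p q) where
  continuous_const_smul u := by
    change Continuous fun A : SO p q => if u = 1 then A else A.conj
    rcases Int.units_eq_one_or u with rfl | rfl
    · exact continuous_id
    · simp only [show (-1 : ℤˣ) ≠ 1 by decide, if_false]
      exact Continuous.subtype_mk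
        ((continuous_const.matrix_mul SO.continuous_mat).matrix_mul continuous_const) _

/-! ### Flags and projective spaces -/

/-- The quotient topology on the space of lines in `ℝᵖ`. -/
instance : TopologicalSpace (ℙ ℝ (EuclideanSpace ℝ (Fin p))) :=
  inferInstanceAs
    (TopologicalSpace (Quotient (projectivizationSetoid ℝ (EuclideanSpace ℝ (Fin p)))))

/-- The action of `u` on lines in `ℝ^{p,q}`. -/
def lineAct (p q : ℕ) (u : ℤˣ) (ℓ : ℙ ℝ (EuclideanSpace ℝ (Fin p))) :
    ℙ ℝ (EuclideanSpace ℝ (Fin p)) :=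
  Projectivization.map (stdRep p q u).toLinearEquiv.toLinearMap (stdRep p q u).injective ℓ

theorem lineAct_mk (u : ℤˣ) (v : EuclideanSpace ℝ (Fin p)) (hv : v ≠ 0) :
    lineAct p q u (Projectivization.mk ℝ v hv) =
      Projectivization.mk ℝ (stdRep p q u v) (by simpa using hv) := rfl

theorem continuous_lineAct (u : ℤˣ) : Continuous (lineAct p q u) := by
  refine continuous_quot_lift _ ?_
  refine continuous_quot_mk.comp (Continuous.subtype_mk ?_ _)
  exact (stdRep p q u).continuous.comp continuous_subtype_val

/-- The reflection `r(ℓ)` across the hyperplane orthogonal to the line `ℓ`. -/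
def refl (ℓ : ℙ ℝ (EuclideanSpace ℝ (Fin p))) :
    EuclideanSpace ℝ (Fin p) ≃ₗᵢ[ℝ] EuclideanSpace ℝ (Fin p) :=
  (ℓ.submodule)ᗮ.reflection

theorem det_refl (ℓ : ℙ ℝ (EuclideanSpace ℝ (Fin p))) :
    LinearMap.det (refl ℓ).toLinearEquiv.toLinearMap = -1 := by
  have h := Submodule.det_reflection (𝕜 := ℝ) (ℓ.submodule)ᗮ
  rw [Submodule.orthogonal_orthogonal, ℓ.finrank_submodule, pow_one] at h
  exact h

/-- The matrix of a linear isometry of `ℝᵖ` with respect to the standard basis. -/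
def isoMat (T : EuclideanSpace ℝ (Fin p) ≃ₗᵢ[ℝ] EuclideanSpace ℝ (Fin p)) :
    Matrix (Fin p) (Fin p) ℝ :=
  LinearMap.toMatrixOrthonormal (EuclideanSpace.basisFun (Fin p) ℝ) T.toLinearEquiv.toLinearMap

theorem isoMat_mul_transpose (T : EuclideanSpace ℝ (Fin p) ≃ₗᵢ[ℝ] EuclideanSpace ℝ (Fin p)) :
    isoMat T * (isoMat T).transpose = 1 := by
  have h := T.toMatrix_mem_unitaryGroup (EuclideanSpace.basisFun (Fin p) ℝ)
    (EuclideanSpace.basisFun (Fin p) ℝ)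
  have h' := Matrix.mem_unitaryGroup_iff.1 h
  rw [Matrix.star_eq_conjTranspose, Matrix.conjTranspose_eq_transpose_of_trivial] at h'
  exact h'

/-- A flag `0 = V₀ ⊂ V₁ ⊂ ⋯ ⊂ V_p = ℝ^{p,q}` of `ℤ/2`-stable subspaces with `dim V_i = i`, starting
with the line `V₁` that is spanned by `e₁`. -/
structure Flag (p q : ℕ) [NeZero p] where
  V : Fin (p + 1) → Submodule ℝ (EuclideanSpace ℝ (Fin p))
  mono : Monotone V
  finrank_eq : ∀ i, Module.finrank ℝ (V i) = i
  stable : ∀ i (u : ℤˣ), ∀ x ∈ V i, stdRep p q u x ∈ V i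
  first : V (Fin.succ 0) = Submodule.span ℝ {EuclideanSpace.single (0 : Fin p) (1 : ℝ)}

/-- Unit vectors `f i` (`0 ≤ i < p`) that span the orthogonal complement of `V i` in `V (i + 1)`;
they exist, and each of them is unique up to sign. -/
structure Flag.Frame [NeZero p] (F : Flag p q) where
  f : Fin p → EuclideanSpace ℝ (Fin p)
  norm_eq : ∀ i, ‖f i‖ = 1
  mem : ∀ i, f i ∈ F.V i.succ
  orth : ∀ i, f i ∈ (F.V i.castSucc)ᗮ

/-- `P^i = ℙ(V_{i+1})`, for `0 ≤ i < p`, as a space of lines in `ℝ^{p,q}`. -/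
def Flag.P [NeZero p] (F : Flag p q) (i : Fin p) : Type :=
  {ℓ : ℙ ℝ (EuclideanSpace ℝ (Fin p)) // ℓ.submodule ≤ F.V i.succ}

section projective

theorem castLE_lt {i : Fin p} (k : Fin i) : Fin.castLE i.is_lt.le k < i := k.is_lt

variable [NeZero p] {F : Flag p q} {i : Fin p}

/-- The line in `ℝ^{p,q}` that is a given point of `P^i`. -/
def Flag.P.line (ℓ : F.P i) : ℙ ℝ (EuclideanSpace ℝ (Fin p)) := Subtype.val ℓ

instance : TopologicalSpace (F.P i) :=
  inferInstanceAs (TopologicalSpace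
    {ℓ : ℙ ℝ (EuclideanSpace ℝ (Fin p)) // ℓ.submodule ≤ F.V i.succ})

/-- The action of `ℤ/2` on `P^i` inherited from `ℝ^{p,q}`. -/
instance : MulAction ℤˣ (F.P i) where
  smul u ℓ := ⟨lineAct p q u ℓ.line, by
    obtain ⟨ℓ, hℓ⟩ := ℓ
    induction ℓ using Projectivization.ind with
    | h v hv =>
      rw [Projectivization.submodule_mk, Submodule.span_singleton_le_iff_mem] at hℓ
      change (lineAct p q u (Projectivization.mk ℝ v hv)).submodule ≤ _
      rw [lineAct_mk, Projectivization.submodule_mk, Submodule.span_singleton_le_iff_mem]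
      exact F.stable _ u v hℓ⟩
  one_smul ℓ := by
    apply Subtype.ext
    obtain ⟨ℓ, hℓ⟩ := ℓ
    change lineAct p q 1 ℓ = ℓ
    induction ℓ using Projectivization.ind with
    | h v hv => simp [lineAct_mk]
  mul_smul u v ℓ := by
    apply Subtype.ext
    obtain ⟨ℓ, hℓ⟩ := ℓ
    change lineAct p q (u * v) ℓ = lineAct p q u (lineAct p q v ℓ)
    induction ℓ using Projectivization.ind with
    | h v hv => simp [lineAct_mk]

instance : ContinuousConstSMul ℤˣ (F.P i) where
  continuous_const_smul u :=
    Continuous.subtype_mk ((continuous_lineAct u).comp continuous_subtype_val) _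

/-- The inclusion `P^j ⊆ P^i` for `j ≤ i`. -/
def Flag.P.incl {j : Fin p} (h : j ≤ i) (ℓ : F.P j) : F.P i :=
  ⟨ℓ.line, le_trans ℓ.2 (F.mono (Fin.succ_le_succ_iff.2 h))⟩

/-- The line spanned by `e₁`. -/
def lineE1 (p : ℕ) [NeZero p] : ℙ ℝ (EuclideanSpace ℝ (Fin p)) :=
  Projectivization.mk ℝ (EuclideanSpace.single (0 : Fin p) (1 : ℝ)) (by simp)

/-- The map `ω` on lines in `ℝ^{p,q}`: `ω(ℓ) = r(ℓ) r(e₁)`. -/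
def omegaLine (q : ℕ) (ℓ : ℙ ℝ (EuclideanSpace ℝ (Fin p))) : SO p q :=
  SO.mk (isoMat (refl ℓ * refl (lineE1 p))) (isoMat_mul_transpose _) (by
    have h : (refl ℓ * refl (lineE1 p)).toLinearEquiv.toLinearMap =
      (refl ℓ).toLinearEquiv.toLinearMap ∘ₗ (refl (lineE1 p)).toLinearEquiv.toLinearMap := rfl
    have h2 : LinearMap.det (refl ℓ * refl (lineE1 p)).toLinearEquiv.toLinearMap = 1 := by
      rw [h, LinearMap.det_comp, det_refl, det_refl]; norm_num
    rw [← h2]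
    exact LinearMap.det_toMatrix (EuclideanSpace.basisFun (Fin p) ℝ).toBasis _)

/-- `P^I = P^{i₁} × ⋯ × P^{i_m}` for a sequence `I = (i₁, …, i_m)`; `ℤ/2` acts diagonally. -/
abbrev Flag.PSeq (F : Flag p q) (I : List (Fin p)) : Type := ∀ k : Fin I.length, F.P (I.get k)

/-- `ω : P^I → SO(p,q)`, `ω(ℓ₁, …, ℓ_m) = ω(ℓ₁) ⋯ ω(ℓ_m)`. -/
def omega (F : Flag p q) (I : List (Fin p)) (v : F.PSeq I) : SO p q :=
  (List.ofFn fun k => omegaLine q (v k).line).prod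

/-! ### Characteristic maps -/

namespace Flag.Frame

theorem mem_of_lt (f : F.Frame) {i j : Fin p} (h : i < j) : f.f i ∈ F.V j.castSucc :=
  F.mono (show i.succ ≤ j.castSucc from Nat.succ_le_of_lt h) (f.mem i)

theorem orthonormal (f : F.Frame) : Orthonormal ℝ f.f := by
  refine ⟨f.norm_eq, fun i j hij => ?_⟩
  rcases lt_or_gt_of_ne hij with h | h
  · exact (F.V j.castSucc).inner_right_of_mem_orthogonal (f.mem_of_lt h) (f.orth j)
  · exact (F.V i.castSucc).inner_left_of_mem_orthogonal (f.mem_of_lt h) (f.orth i)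

/-- The vector `x₁ f₀ + ⋯ + x_i f_{i-1} + √(1 - ‖x‖²) f_i` of the upper unit hemisphere of
`V_{i+1}`, for `x` in the unit disc of `ℝⁱ`. -/
def hemi (f : F.Frame) (i : Fin p) (x : Disc (EuclideanSpace ℝ (Fin i))) :
    EuclideanSpace ℝ (Fin p) :=
  ∑ k : Fin i, (x : EuclideanSpace ℝ (Fin i)) k • f.f (Fin.castLE i.is_lt.le k) +
    √(1 - ‖(x : EuclideanSpace ℝ (Fin i))‖ ^ 2) • f.f i

theorem hemi_mem (f : F.Frame) (i : Fin p) (x : Disc (EuclideanSpace ℝ (Fin i))) :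
    f.hemi i x ∈ F.V i.succ :=
  Submodule.add_mem _
    (Submodule.sum_mem _ fun k _ => Submodule.smul_mem _ _
      (F.mono (Fin.castSucc_lt_succ).le (f.mem_of_lt (castLE_lt k))))
    (Submodule.smul_mem _ _ (f.mem i))

theorem hemi_ne_zero (f : F.Frame) (i : Fin p) (x : Disc (EuclideanSpace ℝ (Fin i))) :
    f.hemi i x ≠ 0 := by
  intro h
  have hx := mem_closedBall_zero_iff.1 x.2
  have ho := f.orthonormal
  have h1 : √(1 - ‖(x : EuclideanSpace ℝ (Fin i))‖ ^ 2) = 0 := by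
    have := congrArg (fun v => inner ℝ (f.f i) v) h
    simp only [hemi, inner_add_right, inner_sum, inner_smul_right, inner_zero_right,
      real_inner_self_eq_norm_sq, f.norm_eq] at this
    rw [Finset.sum_eq_zero] at this
    · simpa using this
    · intro k _
      rw [ho.2 (castLE_lt k).ne', mul_zero]
  have h2 : (x : EuclideanSpace ℝ (Fin i)) = 0 := by
    have hl : LinearIndependent ℝ fun k : Fin i => f.f (Fin.castLE i.is_lt.le k) :=
      ho.linearIndependent.comp _ (Fin.castLE_injective _)
    rw [hemi, h1, zero_smul, add_zero] at h
    ext k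
    exact Fintype.linearIndependent_iff.1 hl _ h k
  rw [h2] at h1
  simp at h1

/-- The characteristic map `φ^i : D^i → P^i` of the `i`-cell of `P^i`, sending `x` to the line
through `x₁ f₀ + ⋯ + x_i f_{i-1} + √(1 - ‖x‖²) f_i`. -/
def phi (f : F.Frame) (i : Fin p) (x : Disc (EuclideanSpace ℝ (Fin i))) : F.P i :=
  ⟨Projectivization.mk ℝ (f.hemi i x) (f.hemi_ne_zero i x), by
    rw [Projectivization.submodule_mk, Submodule.span_singleton_le_iff_mem]
    exact f.hemi_mem i x⟩

open Classical in
/-- The sign by which `ℤ/2` acts on the line spanned by `f i`. -/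
def sign (f : F.Frame) (i : Fin p) : ℤˣ →* ℤˣ :=
  if stdRep p q (-1) (f.f i) = f.f i then 1 else MonoidHom.id ℤˣ

/-- The underlying Euclidean space `ℝ^{a₁} × ⋯ × ℝ^{a_m}` of the representation of a cell. -/
abbrev CellSpace {m : ℕ} (a : Fin m → Fin p) : Type :=
  EuclideanSpace ℝ (Σ k : Fin m, Fin (a k))

/-- The direct sum of the representations on the `ℝ^{a k}` for which the maps `φ^{a k}` are
equivariant: the coordinate of index `j` in `ℝ^{a k}` is multiplied by the product of the signs
of `f j` and of `f (a k)`. -/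
def cellRep (f : F.Frame) {m : ℕ} (a : Fin m → Fin p) :
    ℤˣ →* (CellSpace a ≃ₗᵢ[ℝ] CellSpace a) :=
  signRep fun z => f.sign (Fin.castLE (a z.1).is_lt.le z.2) * f.sign (a z.1)

/-- The identity `x ↦ (x₁, …, x_m)` from `ℝ^{a₁} × ⋯ × ℝ^{a_m}` with the Euclidean norm to
the same space with the norm `max ‖x_k‖`. -/
def splitEquiv {m : ℕ} (a : Fin m → Fin p) :
    CellSpace a ≃L[ℝ] (∀ k : Fin m, EuclideanSpace ℝ (Fin (a k))) :=
  LinearEquiv.toContinuousLinearEquiv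
    { toFun := fun x k => WithLp.toLp 2 fun j => x ⟨k, j⟩
      invFun := fun y => WithLp.toLp 2 fun z => y z.1 z.2
      map_add' := fun _ _ => rfl
      map_smul' := fun _ _ => rfl
      left_inv := fun _ => rfl
      right_inv := fun _ => rfl }

/-- The product of discs `D^a = D^{a₁} × ⋯ × D^{a_m}`. -/
abbrev Polydisc {m : ℕ} (a : Fin m → Fin p) : Type :=
  ∀ k : Fin m, Disc (EuclideanSpace ℝ (Fin (a k)))

/-- The homeomorphism from the unit disc of the cell representation to the product of
discs `D^a = D^{a₁} × ⋯ × D^{a_m}`, which is the unit disc for the norm `max ‖x_k‖`, by rescaling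
along rays. -/
def discHomeo {m : ℕ} (a : Fin m → Fin p) : Disc (CellSpace a) ≃ₜ Polydisc a :=
  (radialHomeo (splitEquiv a)).trans
    { toFun := fun y k => ⟨y.1 k, mem_closedBall_zero_iff.2
        ((norm_le_pi_norm y.1 k).trans (mem_closedBall_zero_iff.1 y.2))⟩
      invFun := fun y => ⟨fun k => (y k).1, mem_closedBall_zero_iff.2
        ((pi_norm_le_iff_of_nonneg zero_le_one).2 fun k => mem_closedBall_zero_iff.1 (y k).2)⟩
      left_inv := fun _ => rfl
      right_inv := fun _ => rfl
      continuous_toFun := continuous_pi fun k =>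
        Continuous.subtype_mk ((continuous_apply k).comp continuous_subtype_val) _
      continuous_invFun := Continuous.subtype_mk
        (continuous_pi fun k => continuous_subtype_val.comp (continuous_apply k)) _ }

/-- The product `φ^I : D^I → P^I` of the maps `φ^{i_k}`. -/
def phiSeq (f : F.Frame) (I : List (Fin p)) (x : Polydisc I.get) : F.PSeq I :=
  fun k => f.phi (I.get k) (x k)

/-- The product of the characteristic maps `φ^{J k} : D^{J k} → P^{J k} ⊆ P^{I k}`, for a sequence
`J ≤ I`; these are the characteristic maps of the product cells of `P^I`. -/
def phiSub (f : F.Frame) (I : List (Fin p)) (J : ∀ k : Fin I.length, {j : Fin p // j ≤ I.get k})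
    (x : Polydisc fun k => (J k).1) : F.PSeq I :=
  fun k => (f.phi (J k).1 (x k)).incl (J k).2

end Flag.Frame

/-- Admissible sequences: `p > i₁ > ⋯ > i_m > 0` with `m ≥ 1`, and the sequence `(0)`. -/
def Admissible (I : List (Fin p)) : Prop :=
  I = [0] ∨ (I ≠ [] ∧ I.Pairwise (· > ·) ∧ ∀ i ∈ I, 0 < i)

/-- The sequence `(p - 1, p - 2, …, 1)`. -/
def topSeq (p : ℕ) [NeZero p] : List (Fin p) :=
  (List.finRange p).reverse.filter fun i => 0 < i

end projective

end Rot

end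

/-! A finite family of continuous equivariant discs in a Hausdorff space gives a `Rep(G)`-complex as
soon as the open cells are disjoint and embedded injectively, each boundary point lies in a cell of
lower dimension, and the discs cover: this is `areCharMaps_skeleton`, where compactness supplies all
the topology. For a product of projective spaces these conditions are checked factor by factor,
`φ^i` being the parametrization of lines by the closed upper hemisphere of `V_{i+1}`.

For the rotation group, let `rot i` be the image of `P^i` under `ω`. Three relations carry the
argument: `rot 0 = 1`, `rot i * rot j = rot j * rot i` (`rot_mul_comm`), and `rot i * rot i ⊆ rot i
* rot (i - 1)` for `i > 0` (`rot_mul_self_subset`). They reduce any product of such sets to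
admissible ones without raising the total dimension (`exists_admissible`). On the boundary of `D^I`
some factor `P^{i_k}` drops to `P^{i_k - 1}`, so the boundary lies in cells of lower dimension; the
same reduction applied to a product cell shows that `ω` is cellular.

The cells cover because every rotation is a product of rotations `ω(ℓ)`: the frame vectors are
restored one at a time, from the last downwards, by reflections (`exists_word`). The open cells are
disjoint because the leading index and line can be recovered from the product `T`
(`rotProd_injective`): for `i = i₁ > 0`, later factors fix `f_i`, so `T f_i = r(ℓ₁) f_i ≠ f_i`,
whereas `T f_j = f_j` for `j > i`. Equivariance holds since `r(gℓ) = g r(ℓ) g` and `g` preserves the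
line of `e₁`. -/

namespace RepCell

/-! ### Recognizing finite `Rep(G)`-complexes -/

section skeleton

variable {X ι : Type*} {V : ι → Type*} [∀ i, NormedAddCommGroup (V i)]
    [∀ i, InnerProductSpace ℝ (V i)]

/-- The union of the images of the cells of dimension at most `n`. -/
def skeleton (Φ : ∀ i, Disc (V i) → X) (n : ℕ) : Set X :=
  {a | ∃ i, Module.finrank ℝ (V i) ≤ n ∧ a ∈ range (Φ i)}

theorem mem_skeleton (Φ : ∀ i, Disc (V i) → X) {i : ι} {n : ℕ}
    (h : Module.finrank ℝ (V i) ≤ n) (x : Disc (V i)) : Φ i x ∈ skeleton Φ n :=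
  ⟨i, h, x, rfl⟩

/-- Descent on dimension: a boundary point can be moved into a smaller cell, and this must stop in
the interior of some cell. It makes skeleta disjoint from the open cells of higher dimension. -/
theorem exists_open_cell (Φ : ∀ i, Disc (V i) → X)
    (hbd : ∀ i (x : Disc (V i)), ‖(x : V i)‖ = 1 →
      ∃ j, Module.finrank ℝ (V j) < Module.finrank ℝ (V i) ∧ Φ i x ∈ range (Φ j)) :
    ∀ (n : ℕ), ∀ a ∈ skeleton Φ n, ∃ i, Module.finrank ℝ (V i) ≤ n ∧
      ∃ x : Disc (V i), ‖(x : V i)‖ < 1 ∧ Φ i x = a := by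
  intro n
  induction n using Nat.strong_induction_on with
  | _ n ih =>
    rintro a ⟨i, hi, x, rfl⟩
    rcases (mem_closedBall_zero_iff.1 x.2).lt_or_eq with h | h
    · exact ⟨i, hi, x, h, rfl⟩
    · obtain ⟨j, hj, hx⟩ := hbd i x h
      obtain ⟨k, hk, y, hy⟩ := ih _ (hj.trans_le hi) _ ⟨j, le_rfl, hx⟩
      exact ⟨k, hk.trans (hj.trans_le hi).le, y, hy⟩

variable [TopologicalSpace X] [∀ i, FiniteDimensional ℝ (V i)]

theorem isCompact_skeleton [Finite ι] (Φ : ∀ i, Disc (V i) → X) (hcont : ∀ i, Continuous (Φ i))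
    (n : ℕ) : IsCompact (skeleton Φ n) := by
  have h : skeleton Φ n = ⋃ i ∈ {i | Module.finrank ℝ (V i) ≤ n}, range (Φ i) := by
    ext a; simp [skeleton]
  rw [h]
  refine (toFinite _).isCompact_biUnion fun i _ => ?_
  have : CompactSpace (Disc (V i)) := isCompact_iff_compactSpace.1 (isCompact_closedBall _ _)
  exact isCompact_range (hcont i)

/-- Finitely many equivariant cells with disjoint open cells that cover a Hausdorff space and with
boundaries in cells of lower dimension are the characteristic maps of a `Rep(G)`-complex. -/
theorem areCharMaps_skeleton {G : Type*} [Group G] [MulAction G X] [ContinuousConstSMul G X]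
    [T2Space X] [Finite ι] (ρ : ∀ i, G →* (V i ≃ₗᵢ[ℝ] V i))
    (Φ : ∀ i, Disc (V i) → X) (hcont : ∀ i, Continuous (Φ i))
    (hequiv : ∀ i (g : G) (x : Disc (V i)), Φ i (discAct (ρ i) g x) = g • Φ i x)
    (hbd : ∀ i (x : Disc (V i)), ‖(x : V i)‖ = 1 →
      ∃ j, Module.finrank ℝ (V j) < Module.finrank ℝ (V i) ∧ Φ i x ∈ range (Φ j))
    (hinj : ∀ i j (x : Disc (V i)) (y : Disc (V j)), ‖(x : V i)‖ < 1 → ‖(y : V j)‖ < 1 →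
      Φ i x = Φ j y → (⟨i, x⟩ : Σ i, Disc (V i)) = ⟨j, y⟩)
    (hsurj : ∀ a, ∃ i, a ∈ range (Φ i)) :
    AreCharMaps ρ Φ (skeleton Φ) := by
  have hcomp := isCompact_skeleton Φ hcont
  have hmono : ∀ {m n : ℕ}, m ≤ n → skeleton Φ m ⊆ skeleton Φ n := by
    rintro m n h a ⟨i, hi, ha⟩
    exact ⟨i, hi.trans h, ha⟩
  have hopen := exists_open_cell Φ hbd
  have hsub : ∀ i, Module.finrank ℝ (V i) = 0 → ∀ x : Disc (V i), (x : V i) = 0 := by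
    intro i hi x
    have := Module.finrank_zero_iff.1 hi
    exact Subsingleton.elim _ _
  have hdisj : ∀ i j (x : Disc (V i)) (y : Disc (V j)), ‖(x : V i)‖ < 1 → ‖(y : V j)‖ < 1 →
      Φ i x = Φ j y → i = j := fun i j x y hx hy h => (Sigma.mk.inj_iff.1 (hinj i j x y hx hy h)).1
  have hzero : ∀ i n, Module.finrank ℝ (V i) = 0 → ∀ x, Φ i x ∈ skeleton Φ n :=
    fun i n hi x => mem_skeleton Φ (hi.le.trans n.zero_le) x
  refine ⟨⟨?_, ?_, fun i => i.2, fun i => hequiv i, fun n => hmono n.le_succ, ?_, ?_, ?_, ?_, ?_, ?_⟩,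
    fun i _ => hequiv i, fun i hi => hzero i 0 hi, ?_⟩
  · have : (skeleton Φ 0).Finite := by
      -- A zero-dimensional disc is only its centre, so the `0`-skeleton is a finite subset of a
      -- Hausdorff space and hence discrete.
      have h : skeleton Φ 0 ⊆ range fun i => Φ i ⟨0, by simp⟩ := by
        rintro a ⟨i, hi, x, rfl⟩
        refine ⟨i, congrArg _ (Subtype.ext (hsub i (Nat.le_zero.1 hi) x).symm)⟩
      exact (finite_range _).subset h
    have := this.to_subtype
    infer_instance
  · rintro g _ ⟨i, hi, x, rfl⟩
    exact ⟨i, hi, discAct (ρ i) g x, hequiv i g x⟩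
  · intro i n hi x hx
    obtain ⟨j, hj, h⟩ := hbd i x hx
    exact ⟨j, by omega, h⟩
  · intro n
    have hmaps : ∀ z, attachMap (fun i : {i : ι // 0 < Module.finrank ℝ (V i)} => Φ i)
        (skeleton Φ n) (n + 1) z ∈ skeleton Φ (n + 1) := by
      rintro (a | ⟨i, x⟩)
      · exact hmono n.le_succ a.2
      · exact mem_skeleton Φ i.2.le x
    refine ⟨hmaps, ?_⟩
    have : CompactSpace (skeleton Φ n) := isCompact_iff_compactSpace.1 (hcomp n)
    have : ∀ i, CompactSpace (Disc (V i)) :=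
      fun i => isCompact_iff_compactSpace.1 (isCompact_closedBall _ _)
    have hc : Continuous (Set.codRestrict (attachMap
        (fun i : {i : ι // 0 < Module.finrank ℝ (V i)} => Φ i) (skeleton Φ n) (n + 1))
        (skeleton Φ (n + 1)) hmaps) :=
      Continuous.subtype_mk (continuous_subtype_val.sumElim
        (continuous_sigma fun i => hcont i.1)) _
    -- The source is a finite disjoint union of compact spaces and the target is Hausdorff, so
    -- continuity already makes the map closed; only surjectivity remains.
    refine hc.isClosedMap.isQuotientMap hc ?_
    rintro ⟨a, i, hi, x, rfl⟩
    rcases Nat.lt_or_ge (Module.finrank ℝ (V i)) (n + 1) with h | h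
    · exact ⟨Sum.inl ⟨_, mem_skeleton Φ (Nat.lt_succ_iff.1 h) x⟩, rfl⟩
    · exact ⟨Sum.inr ⟨⟨⟨i, by omega⟩, le_antisymm hi h⟩, x⟩, rfl⟩
  · intro i n hi x hx h
    obtain ⟨j, hj, y, hy, hxy⟩ := hopen n _ h
    have := hdisj _ _ _ _ hy hx hxy
    subst this
    omega
  · rintro ⟨i, hi⟩ ⟨j, hj⟩ - x y hx hy h
    have := hinj i j x y hx hy h
    obtain ⟨rfl, h2⟩ := Sigma.mk.inj_iff.1 this
    rw [eq_of_heq h2]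
  · refine eq_univ_of_forall fun a => ?_
    obtain ⟨i, x, rfl⟩ := hsurj a
    exact mem_iUnion.2 ⟨_, mem_skeleton Φ le_rfl x⟩
  · intro A hA
    -- With finitely many cells the filtration stabilizes, so the colimit topology is tested on one
    -- skeleton.
    obtain ⟨N, hN⟩ := (finite_range fun i => Module.finrank ℝ (V i)).bddAbove
    have huniv : skeleton Φ N = univ := eq_univ_of_forall fun a => by
      obtain ⟨i, h⟩ := hsurj a
      exact ⟨i, hN ⟨i, rfl⟩, h⟩
    have h := (hcomp N).isClosed.isClosedEmbedding_subtypeVal.isClosedMap _ (hA N)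
    rwa [Subtype.image_preimage_coe, huniv, univ_inter] at h
  · rintro _ ⟨i, hi, x, rfl⟩
    have hi' := Nat.le_zero.1 hi
    refine ⟨i, ⟨hi', x, rfl⟩, ?_⟩
    rintro j ⟨hj, y, hy⟩
    exact hdisj _ _ y x (by simp [hsub j hj y]) (by simp [hsub i hi' x]) hy

end skeleton

end RepCell

namespace Rot

/-! ### Hyperplane reflections -/

section hyperplane

variable {E : Type*} [NormedAddCommGroup E] [InnerProductSpace ℝ E]

/-- The reflection across the hyperplane orthogonal to the vector `v`. -/
noncomputable def vecRefl (v : E) : E ≃ₗᵢ[ℝ] E := (Submodule.span ℝ {v})ᗮ.reflection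

theorem vecRefl_apply (v w : E) :
    vecRefl v w = w - (2 * inner ℝ v w / inner ℝ v v) • v := by
  have h := Submodule.reflection_singleton_apply (𝕜 := ℝ) v w
  have h' := Submodule.reflection_orthogonal_apply (Submodule.span ℝ {v}) w
  rw [h, neg_sub] at h'
  have h2 : (2 * inner ℝ v w / inner ℝ v v : ℝ) • v =
      (2 : ℕ) • ((inner ℝ v w / ‖v‖ ^ 2 : ℝ) • v) := by
    rw [real_inner_self_eq_norm_sq, ← Nat.cast_smul_eq_nsmul ℝ, smul_smul, mul_div_assoc,
      Nat.cast_ofNat]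
  rw [h2]
  exact h'

theorem vecRefl_mul_self (v : E) : vecRefl v * vecRefl v = 1 := by
  ext w
  exact Submodule.reflection_reflection (Submodule.span ℝ {v})ᗮ w

theorem vecRefl_inv (v : E) : (vecRefl v)⁻¹ = vecRefl v :=
  inv_eq_of_mul_eq_one_left (vecRefl_mul_self v)

theorem vecRefl_of_inner_eq_zero {v w : E} (h : inner ℝ v w = 0) : vecRefl v w = w := by
  simp [vecRefl_apply, h]

theorem vecRefl_mem {K : Submodule ℝ E} {v w : E} (hv : v ∈ K) (hw : w ∈ K) :
    vecRefl v w ∈ K := by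
  rw [vecRefl_apply]
  exact K.sub_mem hw (K.smul_mem _ hv)

theorem vecRefl_smul {c : ℝ} (hc : c ≠ 0) (v : E) : vecRefl (c • v) = vecRefl v := by
  unfold vecRefl
  congr 2
  exact Submodule.span_singleton_smul_eq (IsUnit.mk0 c hc) v

theorem vecRefl_map (T : E ≃ₗᵢ[ℝ] E) (v : E) : vecRefl (T v) = T * vecRefl v * T⁻¹ := by
  ext w
  change vecRefl (T v) w = T (vecRefl v (T.symm w))
  have h : inner ℝ (T v) w = inner ℝ v (T.symm w) := by
    rw [← T.inner_map_map v, T.apply_symm_apply]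
  rw [vecRefl_apply, vecRefl_apply, h, T.inner_map_map, map_sub, map_smul, T.apply_symm_apply]

theorem vecRefl_sub {v w : E} (h : ‖v‖ = ‖w‖) : vecRefl (v - w) v = w :=
  Submodule.reflection_sub h

/-- The product of the reflections in `a`, `b` and a vector `a + β b` of their span is a
reflection. -/
theorem exists_vecRefl_mul_vecRefl {a b : E} (β : ℝ) (ha : a ≠ 0) (hb : b ≠ 0)
    (hd : a + β • b ≠ 0) :
    ∃ s t : ℝ, s • a + t • b ≠ 0 ∧
      vecRefl a * vecRefl b = vecRefl (s • a + t • b) * vecRefl (a + β • b) := by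
  set A : ℝ := inner ℝ a a with hA
  set B : ℝ := inner ℝ b b with hB
  set C : ℝ := inner ℝ a b with hC
  have hA0 : A ≠ 0 := by simpa [hA] using ha
  have hB0 : B ≠ 0 := by simpa [hB] using hb
  have hba : inner ℝ b a = C := real_inner_comm _ _
  have hD : inner ℝ (a + β • b) (a + β • b) = A + 2 * β * C + β ^ 2 * B := by
    simp only [inner_add_left, inner_add_right, real_inner_smul_left, real_inner_smul_right, hba]
    ring
  have hD0 : A + 2 * β * C + β ^ 2 * B ≠ 0 := by rw [← hD]; simpa using hd
  have hc : inner ℝ ((2 * C + β * B) • a + (-A) • b) ((2 * C + β * B) • a + (-A) • b) =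
      A * B * (A + 2 * β * C + β ^ 2 * B) := by
    simp only [inner_add_left, inner_add_right, real_inner_smul_left, real_inner_smul_right, hba]
    ring
  -- In a plane identified with `ℂ`, `r_a r_b` is multiplication by `(a b̄) / (ā b)`. With `d = a +
  -- βb`, the vector `c = a b̄ d` satisfies `r_c r_d = r_a r_b`, and `a² b̄ = 2Ca - Ab` turns it
  -- into `(2C + βB)a - Ab`.
  refine ⟨2 * C + β * B, -A, ?_, ?_⟩
  · intro h
    rw [h, inner_zero_left] at hc
    exact mul_ne_zero (mul_ne_zero hA0 hB0) hD0 hc.symm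
  · ext w
    change vecRefl a (vecRefl b w) =
      vecRefl ((2 * C + β * B) • a + (-A) • b) (vecRefl (a + β • b) w)
    simp only [vecRefl_apply]
    rw [hc, hD]
    simp only [inner_add_left, inner_add_right, inner_sub_right, real_inner_smul_left,
      real_inner_smul_right, hba, ← hA, ← hB, ← hC]
    generalize (inner ℝ a w : ℝ) = x
    generalize (inner ℝ b w : ℝ) = y
    clear_value A B C
    obtain ⟨D, hDd⟩ : ∃ D, D = A + 2 * β * C + β ^ 2 * B := ⟨_, rfl⟩
    rw [← hDd] at hD0 ⊢
    match_scalars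
    · ring
    · field_simp
      rw [hDd]
      ring
    · field_simp
      rw [hDd]
      ring

/-- `T d` is orthogonal to the fixed hyperplane, so it is a multiple of `d` of the same norm, that
is `± d`. This settles the last step of the factorization of rotations. -/
theorem eq_one_or_eq_vecRefl {T : E ≃ₗᵢ[ℝ] E} {d : E} (hd : d ≠ 0)
    (h : ∀ w, inner ℝ d w = 0 → T w = w) : T = 1 ∨ T = vecRefl d := by
  have hdec : ∀ w, ∃ (c : ℝ) (w' : E), inner ℝ d w' = 0 ∧ w = c • d + w' := by
    intro w
    refine ⟨inner ℝ d w / inner ℝ d d, w - (inner ℝ d w / inner ℝ d d) • d, ?_, by abel⟩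
    have : inner ℝ d d ≠ (0 : ℝ) := by simpa using hd
    rw [inner_sub_right, real_inner_smul_right]
    field_simp
    ring
  obtain ⟨c, w, hw, hTd⟩ := hdec (T d)
  have hw0 : w = 0 := by
    have h1 : inner ℝ (T d) (T w) = 0 := by rw [T.inner_map_map, hw]
    rw [h w hw, hTd, inner_add_left, real_inner_smul_left, hw, mul_zero, zero_add] at h1
    simpa using h1
  rw [hw0, add_zero] at hTd
  have hn : |c| = 1 := by
    have h1 := T.norm_map d
    rw [hTd, norm_smul, Real.norm_eq_abs] at h1
    exact mul_right_cancel₀ (norm_ne_zero_iff.2 hd) (h1.trans (one_mul _).symm)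
  have hdd : inner ℝ d d ≠ (0 : ℝ) := by simpa using hd
  rcases eq_or_eq_neg_of_abs_eq hn with rfl | rfl
  · left
    ext x
    obtain ⟨s, w', hw', rfl⟩ := hdec x
    rw [map_add, map_smul, hTd, h w' hw', one_smul]
    rfl
  · right
    ext x
    obtain ⟨s, w', hw', rfl⟩ := hdec x
    rw [map_add, map_smul, hTd, h w' hw', map_add, map_smul, vecRefl_of_inner_eq_zero hw',
      vecRefl_apply, mul_div_assoc, div_self hdd, mul_one, two_smul, neg_smul, one_smul]
    congr 2
    abel

end hyperplane


theorem map_vec_ne_zero {E : Type*} [NormedAddCommGroup E] [InnerProductSpace ℝ E]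
    (T : E ≃ₗᵢ[ℝ] E) {v : E} (hv : v ≠ 0) : T v ≠ 0 := by
  simpa using hv

/-- Put `α = r_v r_e`. Since `r_{αw} = α r_w α⁻¹` and `r_{r_e v} = r_e r_v r_e`, the right side
telescopes to `α r_w r_e`. The factors change places: `w` is moved by `α`, while `v` is moved only
by `r_e`. -/
theorem vecRefl_mul_comm {E : Type*} [NormedAddCommGroup E] [InnerProductSpace ℝ E] (v w e : E) :
    (vecRefl v * vecRefl e) * (vecRefl w * vecRefl e) =
      (vecRefl ((vecRefl v * vecRefl e) w) * vecRefl e) *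
        (vecRefl (vecRefl e v) * vecRefl e) := by
  have h := vecRefl_mul_self e
  have h' := vecRefl_mul_self v
  rw [vecRefl_map, vecRefl_map, mul_inv_rev, vecRefl_inv, vecRefl_inv]
  generalize vecRefl v = a at *
  generalize vecRefl e = b at *
  generalize vecRefl w = c at *
  symm
  calc a * b * c * (b * a) * b * (b * a * b * b)
      = a * b * c * (b * a * (b * b) * a * (b * b)) := by simp only [mul_assoc]
    _ = a * b * c * (b * (a * a)) := by rw [h, mul_one, mul_one, mul_assoc b]
    _ = a * b * (c * b) := by rw [h', mul_one, mul_assoc]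

/-! ### Determinants of reflections -/

section determinant

variable {p : ℕ}

theorem refl_mk (v : EuclideanSpace ℝ (Fin p)) (hv : v ≠ 0) :
    refl (Projectivization.mk ℝ v hv) = vecRefl v := by
  simp only [refl, vecRefl, Projectivization.submodule_mk]

theorem det_vecRefl {v : EuclideanSpace ℝ (Fin p)} (hv : v ≠ 0) :
    LinearMap.det (vecRefl v).toLinearEquiv.toLinearMap = -1 := by
  rw [← refl_mk v hv, det_refl]

theorem det_mul (S T : EuclideanSpace ℝ (Fin p) ≃ₗᵢ[ℝ] EuclideanSpace ℝ (Fin p)) :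
    LinearMap.det (S * T).toLinearEquiv.toLinearMap =
      LinearMap.det S.toLinearEquiv.toLinearMap * LinearMap.det T.toLinearEquiv.toLinearMap :=
  LinearMap.det_comp _ _

end determinant

/-! ### Products of the rotations `ω(ℓ)` -/

section words

open scoped Pointwise

variable {p q : ℕ} [NeZero p] {F : Flag p q}

/-- The first standard basis vector. -/
noncomputable def e1 (p : ℕ) [NeZero p] : EuclideanSpace ℝ (Fin p) :=
  EuclideanSpace.single (0 : Fin p) (1 : ℝ)

theorem e1_ne_zero : e1 p ≠ 0 := by simp [e1]

namespace Flag

theorem e1_mem (F : Flag p q) (i : Fin p) : e1 p ∈ F.V i.succ := by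
  refine F.mono (Fin.succ_le_succ_iff.2 (Fin.zero_le i)) ?_
  rw [F.first]
  exact Submodule.mem_span_singleton_self _

namespace Frame

/-- The orthonormal basis of `ℝᵖ` that a frame consists of. -/
noncomputable def basis (f : F.Frame) :
    OrthonormalBasis (Fin p) ℝ (EuclideanSpace ℝ (Fin p)) :=
  OrthonormalBasis.mk f.orthonormal
    (f.orthonormal.linearIndependent.span_eq_top_of_card_eq_finrank' (by simp)).ge

@[simp]
theorem basis_apply (f : F.Frame) (i : Fin p) : f.basis i = f.f i := by
  simp [basis]

theorem ext_inner (f : F.Frame) {v w : EuclideanSpace ℝ (Fin p)}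
    (h : ∀ i, inner ℝ (f.f i) v = inner ℝ (f.f i) w) : v = w := by
  refine f.basis.repr.injective ?_
  ext i
  simpa [OrthonormalBasis.repr_apply_apply] using h i

theorem isometry_ext (f : F.Frame)
    {S T : EuclideanSpace ℝ (Fin p) ≃ₗᵢ[ℝ] EuclideanSpace ℝ (Fin p)}
    (h : ∀ i, S (f.f i) = T (f.f i)) : S = T := by
  have : S.toLinearEquiv.toLinearMap = T.toLinearEquiv.toLinearMap :=
    f.basis.toBasis.ext fun i => by simpa using h i
  ext1 x
  exact LinearMap.congr_fun this x

theorem sum_inner_smul (f : F.Frame) (v : EuclideanSpace ℝ (Fin p)) :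
    ∑ i, inner ℝ (f.f i) v • f.f i = v := by
  simpa using f.basis.sum_repr' v

/-- Expansion in the frame: `V i` is spanned by the `f j` with `j < i`. Membership in the flag
thereby becomes the vanishing of coordinates. -/
theorem mem_V_iff (f : F.Frame) (i : Fin (p + 1)) (v : EuclideanSpace ℝ (Fin p)) :
    v ∈ F.V i ↔ ∀ j : Fin p, i ≤ j.castSucc → inner ℝ (f.f j) v = 0 := by
  refine ⟨fun h j hj => (F.V j.castSucc).inner_left_of_mem_orthogonal (F.mono hj h) (f.orth j),
    fun h => ?_⟩
  rw [← f.sum_inner_smul v]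
  refine Submodule.sum_mem _ fun j _ => ?_
  by_cases hj : i ≤ j.castSucc
  · rw [h j hj, zero_smul]
    exact zero_mem _
  · exact Submodule.smul_mem _ _ (F.mono (Nat.succ_le_of_lt (not_le.1 hj)) (f.mem j))

theorem mem_V_succ_iff (f : F.Frame) (i : Fin p) (v : EuclideanSpace ℝ (Fin p)) :
    v ∈ F.V i.succ ↔ ∀ j, i < j → inner ℝ (f.f j) v = 0 := by
  rw [f.mem_V_iff]
  exact forall_congr' fun j => by rw [Fin.succ_le_castSucc_iff]

theorem mem_V_castSucc_iff (f : F.Frame) (i : Fin p) (v : EuclideanSpace ℝ (Fin p)) :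
    v ∈ F.V i.castSucc ↔ v ∈ F.V i.succ ∧ inner ℝ (f.f i) v = 0 := by
  rw [f.mem_V_iff, f.mem_V_succ_iff]
  simp only [Fin.castSucc_le_castSucc_iff]
  refine ⟨fun h => ⟨fun j hj => h j hj.le, h i le_rfl⟩, fun h j hj => ?_⟩
  rcases hj.lt_or_eq with hj | rfl
  · exact h.1 j hj
  · exact h.2

theorem inner_e1 (f : F.Frame) {i : Fin p} (hi : 0 < i) : inner ℝ (f.f i) (e1 p) = 0 :=
  (f.mem_V_succ_iff 0 _).1 (F.e1_mem 0) i hi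

theorem vecRefl_e1 (f : F.Frame) {i : Fin p} (hi : 0 < i) : vecRefl (e1 p) (f.f i) = f.f i :=
  vecRefl_of_inner_eq_zero (by rw [real_inner_comm, f.inner_e1 hi])

theorem vecRefl_of_mem (f : F.Frame) {i j : Fin p} (h : i < j) {v : EuclideanSpace ℝ (Fin p)}
    (hv : v ∈ F.V i.succ) : vecRefl v (f.f j) = f.f j :=
  vecRefl_of_inner_eq_zero (by rw [real_inner_comm, (f.mem_V_succ_iff i v).1 hv j h])

end Frame

/-- The image of `P^i` under `ω`, as a set of isometries of `ℝᵖ`. -/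
noncomputable def rot (F : Flag p q) (i : Fin p) :
    Set (EuclideanSpace ℝ (Fin p) ≃ₗᵢ[ℝ] EuclideanSpace ℝ (Fin p)) :=
  {T | ∃ v ∈ F.V i.succ, v ≠ 0 ∧ vecRefl v * vecRefl (e1 p) = T}

/-- The image of `P^I` under `ω`, as a set of isometries of `ℝᵖ`. -/
noncomputable def word (F : Flag p q) (I : List (Fin p)) :
    Set (EuclideanSpace ℝ (Fin p) ≃ₗᵢ[ℝ] EuclideanSpace ℝ (Fin p)) :=
  (I.map F.rot).prod

theorem word_nil (F : Flag p q) : F.word [] = 1 := rfl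

theorem word_cons (F : Flag p q) (i : Fin p) (I : List (Fin p)) :
    F.word (i :: I) = F.rot i * F.word I := by
  simp [word]

theorem rot_zero (F : Flag p q) : F.rot 0 = 1 := by
  ext T
  rw [Set.mem_one]
  constructor
  · rintro ⟨v, hv, hv0, rfl⟩
    rw [F.first, Submodule.mem_span_singleton] at hv
    obtain ⟨c, rfl⟩ := hv
    have hc : c ≠ 0 := by
      rintro rfl
      simp at hv0
    change vecRefl (c • e1 p) * _ = 1
    rw [vecRefl_smul hc, vecRefl_mul_self]
  · rintro rfl
    exact ⟨e1 p, F.e1_mem 0, e1_ne_zero, vecRefl_mul_self _⟩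

/-- In `vecRefl_mul_comm` with `v ∈ V_{j+1}` and `w ∈ V_{i+1}`, the new vectors stay in their
subspaces: `V_{i+1}` is stable under `r_v` and `r_e`, and `V_{j+1}` under `r_e`, because it contains
`e₁`. -/
theorem rot_mul_comm_of_le (F : Flag p q) {i j : Fin p} (h : j ≤ i) :
    F.rot j * F.rot i = F.rot i * F.rot j := by
  have hmono := F.mono (Fin.succ_le_succ_iff.2 h)
  apply Subset.antisymm
  · rintro _ ⟨_, ⟨v, hv, hv0, rfl⟩, _, ⟨w, hw, hw0, rfl⟩, rfl⟩
    refine ⟨_, ⟨_, ?_, ?_, rfl⟩, _, ⟨_, ?_, ?_, rfl⟩, (vecRefl_mul_comm v w (e1 p)).symm⟩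
    · change vecRefl v (vecRefl (e1 p) w) ∈ F.V i.succ
      exact vecRefl_mem (hmono hv) (vecRefl_mem (F.e1_mem i) hw)
    · exact map_vec_ne_zero _ hw0
    · exact vecRefl_mem (F.e1_mem j) hv
    · exact map_vec_ne_zero _ hv0
  · rintro _ ⟨_, ⟨v, hv, hv0, rfl⟩, _, ⟨w, hw, hw0, rfl⟩, rfl⟩
    have hm : vecRefl (e1 p) w ∈ F.V j.succ := vecRefl_mem (F.e1_mem j) hw
    have hinv : ∀ u x : EuclideanSpace ℝ (Fin p), vecRefl u (vecRefl u x) = x := fun u x =>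
      congrArg (fun T : EuclideanSpace ℝ (Fin p) ≃ₗᵢ[ℝ] EuclideanSpace ℝ (Fin p) => T x)
        (vecRefl_mul_self u)
    -- These vectors invert the exchange: solving `r_e v' = w` and `r_{v'} r_e w' = v` gives `v' =
    -- r_e w` and `w' = r_e r_{v'} v`.
    refine ⟨_, ⟨vecRefl (e1 p) w, hm, map_vec_ne_zero _ hw0, rfl⟩, _,
      ⟨vecRefl (e1 p) (vecRefl (vecRefl (e1 p) w) v), ?_,
        map_vec_ne_zero _ (map_vec_ne_zero _ hv0), rfl⟩, ?_⟩
    · exact vecRefl_mem (F.e1_mem i) (vecRefl_mem (hmono hm) hv)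
    · refine (vecRefl_mul_comm _ _ (e1 p)).trans ?_
      rw [LinearIsometryEquiv.coe_mul, Function.comp_apply, hinv, hinv, hinv]

theorem rot_mul_comm (F : Flag p q) (i j : Fin p) : F.rot i * F.rot j = F.rot j * F.rot i := by
  rcases le_total i j with h | h
  · exact F.rot_mul_comm_of_le h
  · exact (F.rot_mul_comm_of_le h).symm

theorem word_perm (F : Flag p q) {I J : List (Fin p)} (h : I.Perm J) : F.word I = F.word J :=
  (h.map F.rot).prod_eq' (List.pairwise_map.2 (List.pairwise_of_forall fun i j =>
    F.rot_mul_comm i j))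

/-- An element of the left side has the form `r_a r_b` with `a, b ∈ V_{i+1}`. If they are
independent, their plane meets the hyperplane `V_i` in some `d ≠ 0`, and the pair can be rotated
within the plane so that its second member is `d`. -/
theorem rot_mul_self_subset (f : F.Frame) {i k : Fin p} (h : (i : ℕ) = k + 1) :
    F.rot i * F.rot i ⊆ F.rot i * F.rot k := by
  have hV : F.V k.succ = F.V i.castSucc := congrArg F.V (Fin.ext h.symm)
  have hle : F.V k.succ ≤ F.V i.succ := F.mono (Fin.succ_le_succ_iff.2 (Fin.le_def.2 (by omega)))
  have hi : 0 < i := Fin.pos_iff_ne_zero.2 fun h0 => by simp [h0] at h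
  have key : ∀ c d : EuclideanSpace ℝ (Fin p), c ∈ F.V i.succ → c ≠ 0 → d ∈ F.V k.succ → d ≠ 0 →
      vecRefl c * vecRefl d ∈ F.rot i * F.rot k := by
    intro c d hc hc0 hd hd0
    refine ⟨_, ⟨c, hc, hc0, rfl⟩, _,
      ⟨vecRefl (e1 p) d, vecRefl_mem (F.e1_mem k) hd, map_vec_ne_zero _ hd0, rfl⟩, ?_⟩
    change _ * _ = _
    rw [vecRefl_map, vecRefl_inv]
    have h1 := vecRefl_mul_self (e1 p)
    calc _ = vecRefl c * (vecRefl (e1 p) * vecRefl (e1 p)) * vecRefl d *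
            (vecRefl (e1 p) * vecRefl (e1 p)) := by simp only [mul_assoc]
      _ = _ := by rw [h1, mul_one, mul_one]
  rintro _ ⟨_, ⟨a, ha, ha0, rfl⟩, _, ⟨w, hw, hw0, rfl⟩, rfl⟩
  obtain ⟨b, hb, hb0, hab⟩ : ∃ b ∈ F.V i.succ, b ≠ 0 ∧
      vecRefl a * vecRefl (e1 p) * (vecRefl w * vecRefl (e1 p)) = vecRefl a * vecRefl b := by
    refine ⟨vecRefl (e1 p) w, vecRefl_mem (F.e1_mem i) hw, map_vec_ne_zero _ hw0, ?_⟩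
    rw [vecRefl_map, vecRefl_inv]
    simp only [mul_assoc]
  change vecRefl a * vecRefl (e1 p) * (vecRefl w * vecRefl (e1 p)) ∈ _
  rw [hab]
  by_cases hbk : inner ℝ (f.f i) b = 0
  · exact key a b ha ha0 (hV ▸ (f.mem_V_castSucc_iff i b).2 ⟨hb, hbk⟩) hb0
  -- The coefficient cancels the `f i`-coordinate, so this combination lies in `V_i`. If it
  -- vanishes, `a` and `b` are parallel, the product is `1`, and `1` is written as `r_e r_e`.
  by_cases hd0 : a + (-(inner ℝ (f.f i) a / inner ℝ (f.f i) b) : ℝ) • b = 0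
  · rw [neg_smul, ← sub_eq_add_neg, sub_eq_zero] at hd0
    have hc : (inner ℝ (f.f i) a / inner ℝ (f.f i) b : ℝ) ≠ 0 := by
      intro h0
      rw [h0, zero_smul] at hd0
      exact ha0 hd0
    have h1 : vecRefl a = vecRefl b := by
      rw [hd0, vecRefl_smul hc]
    rw [h1, vecRefl_mul_self, ← vecRefl_mul_self (e1 p)]
    exact key _ _ (F.e1_mem i) e1_ne_zero (F.e1_mem k) e1_ne_zero
  · obtain ⟨s, t, hst, h1⟩ := exists_vecRefl_mul_vecRefl _ ha0 hb0 hd0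
    rw [h1]
    refine key _ _ (Submodule.add_mem _ (Submodule.smul_mem _ _ ha) (Submodule.smul_mem _ _ hb))
      hst ?_ hd0
    rw [hV, f.mem_V_castSucc_iff]
    refine ⟨Submodule.add_mem _ ha (Submodule.smul_mem _ _ hb), ?_⟩
    rw [inner_add_right, real_inner_smul_right]
    field_simp
    ring

/-- Every product of rotations `ω(ℓ)` lies in the image of an admissible product of projective
spaces of no larger dimension. -/
theorem exists_admissible (f : F.Frame) (I : List (Fin p))
    {T : EuclideanSpace ℝ (Fin p) ≃ₗᵢ[ℝ] EuclideanSpace ℝ (Fin p)} (hT : T ∈ F.word I) :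
    ∃ J, Admissible J ∧ (J.map Fin.val).sum ≤ (I.map Fin.val).sum ∧ T ∈ F.word J := by
  -- Sum plus length decreases in both reductions: deleting a `0` shortens the list but keeps the
  -- sum, and replacing `(i, i)` by `(i, i - 1)` lowers the sum but keeps the length.
  obtain ⟨n, hn⟩ : ∃ n, (I.map Fin.val).sum + I.length = n := ⟨_, rfl⟩
  induction n using Nat.strong_induction_on generalizing I T with
  | _ n ih =>
    by_cases h0 : (0 : Fin p) ∈ I
    · have hperm := List.perm_cons_erase h0
      rw [F.word_perm hperm, F.word_cons, F.rot_zero, one_mul] at hT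
      have hl := hperm.length_eq
      have hs := (hperm.map Fin.val).sum_eq
      simp only [List.length_cons, List.map_cons, List.sum_cons, Fin.val_zero, zero_add] at hl hs
      obtain ⟨J, hJ, hJs, hJT⟩ := ih _ (by omega) _ hT rfl
      exact ⟨J, hJ, by omega, hJT⟩
    by_cases hnd : I.Nodup
    · have hperm := List.perm_insertionSort (· ≥ ·) I
      rw [F.word_perm hperm.symm] at hT
      have hs := (hperm.map Fin.val).sum_eq
      -- The empty sequence is not admissible; its only product, the identity, is assigned to the
      -- cell `(0)`.
      by_cases hnil : I.insertionSort (· ≥ ·) = []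
      · rw [hnil] at hT
        refine ⟨[0], Or.inl rfl, by simp, ?_⟩
        rw [F.word_cons, F.rot_zero, one_mul]
        exact hT
      · refine ⟨_, Or.inr ⟨hnil, ?_, fun i hi => ?_⟩, hs.le, hT⟩
        · refine ((List.pairwise_insertionSort (· ≥ ·) I).and
            (hperm.nodup_iff.2 hnd)).imp fun h => ?_
          exact lt_of_le_of_ne h.1 h.2.symm
        · refine Fin.pos_iff_ne_zero.2 fun h => h0 ?_
          rw [h] at hi
          exact hperm.mem_iff.1 hi
    · obtain ⟨i, hi⟩ := List.exists_duplicate_iff_not_nodup.2 hnd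
      have hi0 : (i : ℕ) ≠ 0 := fun h => h0 (by
        rw [← show i = 0 from Fin.ext h]
        exact hi.mem)
      let k : Fin p := ⟨i - 1, by omega⟩
      have hk : (i : ℕ) = k + 1 := by simp only [k]; omega
      have hperm : I.Perm (i :: i :: (I.erase i).erase i) := by
        refine (List.perm_cons_erase hi.mem).trans (List.Perm.cons _ (List.perm_cons_erase ?_))
        rw [List.duplicate_iff_two_le_count] at hi
        rw [← List.count_pos_iff, List.count_erase_self]
        omega
      rw [F.word_perm hperm, F.word_cons, F.word_cons, ← mul_assoc] at hT
      have hT' : T ∈ F.word (i :: k :: (I.erase i).erase i) := by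
        rw [F.word_cons, F.word_cons, ← mul_assoc]
        exact Set.mul_subset_mul_right (rot_mul_self_subset f hk) hT
      have hl := hperm.length_eq
      have hs := (hperm.map Fin.val).sum_eq
      simp only [List.length_cons, List.map_cons, List.sum_cons] at hl hs
      obtain ⟨J, hJ, hJs, hJT⟩ := ih ((i : ℕ) + (k + (((I.erase i).erase i).map Fin.val).sum) +
        (((I.erase i).erase i).length + 1 + 1)) (by omega) _ hT' (by simp)
      simp only [List.map_cons, List.sum_cons] at hJs
      exact ⟨J, hJ, by omega, hJT⟩

/-- Every rotation is a product of rotations `ω(ℓ)`. -/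
theorem exists_word (f : F.Frame) {T : EuclideanSpace ℝ (Fin p) ≃ₗᵢ[ℝ] EuclideanSpace ℝ (Fin p)}
    (hdet : LinearMap.det T.toLinearEquiv.toLinearMap = 1) : ∃ I, T ∈ F.word I := by
  suffices h : ∀ n : ℕ, ∀ T : EuclideanSpace ℝ (Fin p) ≃ₗᵢ[ℝ] EuclideanSpace ℝ (Fin p),
      LinearMap.det T.toLinearEquiv.toLinearMap = 1 →
      (∀ j : Fin p, n ≤ j → T (f.f j) = f.f j) → ∃ I, T ∈ F.word I from
    h p T hdet fun j hj => absurd j.is_lt (not_lt.2 hj)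
  intro n
  induction n with
  | zero =>
    intro T _ h
    exact ⟨[], f.isometry_ext fun i => h i (Nat.zero_le _)⟩
  | succ n ih =>
    intro T hdet h
    by_cases hn : p ≤ n
    · exact ih T hdet fun j hj => absurd j.is_lt (by omega)
    let i : Fin p := ⟨n, by omega⟩
    by_cases hi : T (f.f i) = f.f i
    · refine ih T hdet fun j hj => ?_
      rcases hj.lt_or_eq with hj | hj
      · exact h j hj
      · rwa [show j = i from Fin.ext hj.symm]
    -- At the last step only `f 0` may move, so `T` is `1` or the reflection in `f 0`; the
    -- determinant excludes the latter.
    by_cases hi0 : i = 0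
    · exfalso
      have hf0 : f.f i ≠ 0 := fun h0 => by simpa [h0] using f.norm_eq i
      have hfix : ∀ w, inner ℝ (f.f i) w = 0 → T w = w := by
        intro w hw
        rw [← f.sum_inner_smul w, map_sum]
        refine Finset.sum_congr rfl fun j _ => ?_
        rw [map_smul]
        by_cases hj : j = i
        · rw [hj, hw, zero_smul, zero_smul]
        · have : (j : ℕ) ≠ n := fun hjn => hj (Fin.ext hjn)
          have : n = 0 := congrArg Fin.val hi0
          rw [h j (by omega)]
      rcases eq_one_or_eq_vecRefl hf0 hfix with h1 | h1
      · exact hi (by rw [h1]; rfl)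
      · rw [h1, det_vecRefl hf0] at hdet
        norm_num at hdet
    · have hipos : 0 < i := Fin.pos_iff_ne_zero.2 hi0
      have hv0 : T (f.f i) - f.f i ≠ 0 := sub_ne_zero.2 hi
      have hv : T (f.f i) - f.f i ∈ F.V i.succ := by
        refine (f.mem_V_succ_iff i _).2 fun j hj => ?_
        have hTj := h j (Nat.succ_le_of_lt hj)
        have ho := f.orthonormal.2 hj.ne'
        rw [inner_sub_right, ho, sub_zero, ← hTj, T.inner_map_map, ho]
      -- `r_v` takes `T f_i` back to `f_i` and fixes every later frame vector. The extra factor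
      -- `r_e` fixes all of these too, as `i > 0`, so `r_e r_v T` is a rotation to which the
      -- induction applies.
      set v := T (f.f i) - f.f i with hvdef
      obtain ⟨I, hI⟩ := ih (vecRefl (e1 p) * (vecRefl v * T)) (by
        rw [det_mul, det_mul, det_vecRefl e1_ne_zero, det_vecRefl hv0, hdet]; norm_num)
        (fun j hj => by
          change vecRefl (e1 p) (vecRefl v (T (f.f j))) = f.f j
          rcases hj.lt_or_eq with hj | hj
          · have hij : i < j := hj
            rw [h j hj, f.vecRefl_of_mem hij hv, f.vecRefl_e1 (hipos.trans hij)]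
          · rw [show j = i from Fin.ext hj.symm, hvdef,
              vecRefl_sub (by rw [T.norm_map]), f.vecRefl_e1 hipos])
      refine ⟨i :: I, ?_⟩
      rw [F.word_cons]
      refine ⟨_, ⟨v, hv, hv0, rfl⟩, _, hI, ?_⟩
      change vecRefl v * vecRefl (e1 p) * (vecRefl (e1 p) * (vecRefl v * T)) = T
      rw [mul_assoc, ← mul_assoc (vecRefl (e1 p)), vecRefl_mul_self, one_mul, ← mul_assoc,
        vecRefl_mul_self, one_mul]

end Flag

end words


/-! ### Disjointness of the open cells of the rotation group -/

section cells

theorem sum_fin_eq {p : ℕ} {M : Type*} [AddCommMonoid M] (i : Fin p) (g : Fin p → M)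
    (hg : ∀ j, i < j → g j = 0) :
    ∑ j, g j = ∑ k : Fin i, g (Fin.castLE i.is_lt.le k) + g i := by
  have h := Fintype.sum_of_injective (Fin.castLE (Nat.succ_le_of_lt i.is_lt))
    (Fin.castLE_injective _) (fun k => g (Fin.castLE (Nat.succ_le_of_lt i.is_lt) k)) g
    (fun j hj => hg j (by
      by_contra hij
      exact hj ⟨⟨j, Nat.lt_succ_of_le (not_lt.1 hij)⟩, rfl⟩)) fun _ => rfl
  rw [← h, Fin.sum_univ_castSucc]
  rfl

variable {p q : ℕ} [NeZero p] {F : Flag p q}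

/-- The product of the rotations `ω(ℓ)` for the lines `ℓ` of a list, as an isometry. -/
noncomputable def rotProd (L : List (ℙ ℝ (EuclideanSpace ℝ (Fin p)))) :
    EuclideanSpace ℝ (Fin p) ≃ₗᵢ[ℝ] EuclideanSpace ℝ (Fin p) :=
  (L.map fun ℓ => refl ℓ * refl (lineE1 p)).prod

theorem rotProd_cons_apply (ℓ : ℙ ℝ (EuclideanSpace ℝ (Fin p)))
    (L : List (ℙ ℝ (EuclideanSpace ℝ (Fin p)))) (x : EuclideanSpace ℝ (Fin p)) :
    rotProd (ℓ :: L) x = refl ℓ (refl (lineE1 p) (rotProd L x)) := by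
  simp [rotProd]

theorem refl_lineE1 : refl (lineE1 p) = vecRefl (e1 p) := refl_mk _ _

/-- The line `ℓ` lies in `P^i` but not in `P^{i-1}`. -/
def Flag.IsOpenCell (F : Flag p q) (i : Fin p) (ℓ : ℙ ℝ (EuclideanSpace ℝ (Fin p))) : Prop :=
  ℓ.submodule ≤ F.V i.succ ∧ ¬ ℓ.submodule ≤ F.V i.castSucc

theorem Flag.IsOpenCell.le {i j : Fin p} {ℓ : ℙ ℝ (EuclideanSpace ℝ (Fin p))}
    (h : F.IsOpenCell i ℓ) (h' : ℓ.submodule ≤ F.V j.succ) : i ≤ j := by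
  by_contra hij
  exact h.2 (h'.trans (F.mono (Fin.succ_le_castSucc_iff.2 (not_le.1 hij))))

theorem Flag.IsOpenCell.unique {i j : Fin p} {ℓ : ℙ ℝ (EuclideanSpace ℝ (Fin p))}
    (h : F.IsOpenCell i ℓ) (h' : F.IsOpenCell j ℓ) : i = j :=
  le_antisymm (h.le h'.1) (h'.le h.1)

namespace Flag.Frame

theorem exists_vector (f : F.Frame) {i : Fin p} {ℓ : ℙ ℝ (EuclideanSpace ℝ (Fin p))}
    (h : F.IsOpenCell i ℓ) : ∃ (v : EuclideanSpace ℝ (Fin p)) (hv : v ≠ 0),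
      ℓ = Projectivization.mk ℝ v hv ∧ inner ℝ (f.f i) v ≠ 0 := by
  induction ℓ using Projectivization.ind with
  | h v hv =>
    refine ⟨v, hv, rfl, fun h0 => h.2 ?_⟩
    have h1 := h.1
    rw [Projectivization.submodule_mk, Submodule.span_singleton_le_iff_mem] at h1 ⊢
    exact (f.mem_V_castSucc_iff i v).2 ⟨h1, h0⟩

theorem refl_apply_ne (f : F.Frame) {i : Fin p} {ℓ : ℙ ℝ (EuclideanSpace ℝ (Fin p))}
    (h : F.IsOpenCell i ℓ) : refl ℓ (f.f i) ≠ f.f i := by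
  obtain ⟨v, hv, rfl, hi⟩ := f.exists_vector h
  have hvv : inner ℝ v v ≠ (0 : ℝ) := by simpa using hv
  rw [real_inner_comm] at hi
  rw [refl_mk, vecRefl_apply, Ne, sub_eq_self]
  exact smul_ne_zero (div_ne_zero (mul_ne_zero two_ne_zero hi) hvv) hv

/-- The displacement `f_i - r(ℓ) f_i` is a nonzero vector of `ℓ`, as `ℓ` is not orthogonal to `f_i`;
hence it determines the line. -/
theorem eq_of_refl_apply_eq (f : F.Frame) {i : Fin p} {ℓ ℓ' : ℙ ℝ (EuclideanSpace ℝ (Fin p))}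
    (h : F.IsOpenCell i ℓ) (h' : F.IsOpenCell i ℓ') (heq : refl ℓ (f.f i) = refl ℓ' (f.f i)) :
    ℓ = ℓ' := by
  obtain ⟨v, hv, rfl, hi⟩ := f.exists_vector h
  obtain ⟨w, hw, rfl, hi'⟩ := f.exists_vector h'
  have hvv : inner ℝ v v ≠ (0 : ℝ) := by simpa using hv
  rw [real_inner_comm] at hi hi'
  rw [refl_mk, refl_mk, vecRefl_apply, vecRefl_apply, sub_right_inj] at heq
  have hc : (2 * inner ℝ v (f.f i) / inner ℝ v v : ℝ) ≠ 0 :=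
    div_ne_zero (mul_ne_zero two_ne_zero hi) hvv
  rw [Projectivization.mk_eq_mk_iff']
  refine ⟨(2 * inner ℝ v (f.f i) / inner ℝ v v : ℝ)⁻¹ *
    (2 * inner ℝ w (f.f i) / inner ℝ w w), ?_⟩
  rw [mul_smul, ← heq, inv_smul_smul₀ hc]

theorem refl_apply_of_le (f : F.Frame) {i j : Fin p} {ℓ : ℙ ℝ (EuclideanSpace ℝ (Fin p))}
    (hij : i < j) (h : ℓ.submodule ≤ F.V i.succ) : refl ℓ (f.f j) = f.f j := by
  induction ℓ using Projectivization.ind with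
  | h v hv =>
    rw [Projectivization.submodule_mk, Submodule.span_singleton_le_iff_mem] at h
    rw [refl_mk, f.vecRefl_of_mem hij h]

theorem rotProd_apply_of_forall_lt (f : F.Frame) {j : Fin p}
    {L : List (ℙ ℝ (EuclideanSpace ℝ (Fin p)))}
    (h : ∀ ℓ ∈ L, ∃ i < j, ℓ.submodule ≤ F.V i.succ) : rotProd L (f.f j) = f.f j := by
  induction L with
  | nil => rfl
  | cons ℓ L ih =>
    obtain ⟨i, hij, hi⟩ := h ℓ List.mem_cons_self
    rw [rotProd_cons_apply, ih fun ℓ hℓ => h ℓ (List.mem_cons_of_mem _ hℓ), refl_lineE1,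
      f.vecRefl_e1 (lt_of_le_of_lt (Fin.zero_le i) hij), f.refl_apply_of_le hij hi]

/-- All factors after the first come from smaller indices and fix `f_i`, as does `r(e₁)`. Thus the
leading line can be read off the product. -/
theorem rotProd_cons_apply_self (f : F.Frame) {i : Fin p} {I : List (Fin p)}
    {ℓ : ℙ ℝ (EuclideanSpace ℝ (Fin p))} {L : List (ℙ ℝ (EuclideanSpace ℝ (Fin p)))}
    (hI : (i :: I).Pairwise (· > ·)) (hi : 0 < i)
    (h : List.Forall₂ F.IsOpenCell I L) : rotProd (ℓ :: L) (f.f i) = refl ℓ (f.f i) := by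
  rw [rotProd_cons_apply, f.rotProd_apply_of_forall_lt, refl_lineE1, f.vecRefl_e1 hi]
  intro ℓ' hℓ'
  obtain ⟨k, hk, rfl⟩ := List.getElem_of_mem hℓ'
  have hlen := h.length_eq
  exact ⟨I[k], (List.pairwise_cons.1 hI).1 _ (List.getElem_mem _), (h.get (by omega) hk).1⟩

theorem rotProd_apply_of_lt (f : F.Frame) {i j : Fin p} {I : List (Fin p)}
    {L : List (ℙ ℝ (EuclideanSpace ℝ (Fin p)))}
    (hI : (i :: I).Pairwise (· > ·)) (hij : i < j)
    (h : List.Forall₂ F.IsOpenCell (i :: I) L) : rotProd L (f.f j) = f.f j := by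
  apply f.rotProd_apply_of_forall_lt
  intro ℓ' hℓ'
  obtain ⟨k, hk, rfl⟩ := List.getElem_of_mem hℓ'
  have hlen := h.length_eq
  refine ⟨(i :: I)[k]'(by omega), ?_, (h.get (by omega) hk).1⟩
  rcases List.mem_cons.1 (List.getElem_mem (l := i :: I) (n := k) (by omega)) with h1 | h1
  · rwa [h1]
  · exact lt_trans ((List.pairwise_cons.1 hI).1 _ h1) hij

/-- The open cells of `SO(p,q)` are disjoint and parametrized injectively by lines. -/
theorem rotProd_injective (f : F.Frame) {I I' : List (Fin p)}
    {L L' : List (ℙ ℝ (EuclideanSpace ℝ (Fin p)))}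
    (hI : I.Pairwise (· > ·)) (hI' : I'.Pairwise (· > ·)) (h0 : ∀ i ∈ I, 0 < i)
    (h0' : ∀ i ∈ I', 0 < i) (h : List.Forall₂ F.IsOpenCell I L)
    (h' : List.Forall₂ F.IsOpenCell I' L') (heq : rotProd L = rotProd L') :
    I = I' ∧ L = L' := by
  induction h generalizing I' L' with
  | nil =>
    cases h' with
    | nil => exact ⟨rfl, rfl⟩
    | @cons _ ℓ _ _ hi hL =>
      exfalso
      have h1 := f.rotProd_cons_apply_self (ℓ := ℓ) hI' (h0' _ List.mem_cons_self) hL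
      rw [← heq] at h1
      exact f.refl_apply_ne hi h1.symm
  | @cons i ℓ I L hi hL ih =>
    have h1 := f.rotProd_cons_apply_self (ℓ := ℓ) hI (h0 _ List.mem_cons_self) hL
    cases h' with
    | nil =>
      exfalso
      rw [heq] at h1
      exact f.refl_apply_ne hi h1.symm
    | @cons i' ℓ' I' L' hi' hL' =>
      have h1' := f.rotProd_cons_apply_self (ℓ := ℓ') hI' (h0' _ List.mem_cons_self) hL'
      rcases lt_trichotomy i i' with hlt | rfl | hlt
      · exfalso
        rw [← heq, f.rotProd_apply_of_lt hI hlt (.cons hi hL)] at h1'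
        exact f.refl_apply_ne hi' h1'.symm
      · have hℓ : ℓ = ℓ' := f.eq_of_refl_apply_eq hi hi' (by rw [← h1, ← h1', heq])
        subst hℓ
        have := ih hI.of_cons hI'.of_cons (fun i hi => h0 i (List.mem_cons_of_mem _ hi))
          (fun i hi => h0' i (List.mem_cons_of_mem _ hi)) hL' (by
            simp only [rotProd, List.map_cons, List.prod_cons] at heq
            exact mul_left_cancel heq)
        exact ⟨by rw [this.1], by rw [this.2]⟩
      · exfalso
        rw [heq, f.rotProd_apply_of_lt hI' hlt (.cons hi' hL')] at h1
        exact f.refl_apply_ne hi h1.symm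

/-! ### The cells of projective spaces -/

open RepCell

theorem inner_hemi (f : F.Frame) (i : Fin p) (x : Disc (EuclideanSpace ℝ (Fin i))) (k : Fin i) :
    inner ℝ (f.f (Fin.castLE i.is_lt.le k)) (f.hemi i x) =
      (x : EuclideanSpace ℝ (Fin i)) k := by
  have ho := f.orthonormal
  rw [hemi, inner_add_right, inner_sum, real_inner_smul_right, ho.2 (castLE_lt k).ne, mul_zero,
    add_zero, Finset.sum_eq_single k]
  · rw [real_inner_smul_right, real_inner_self_eq_norm_sq, f.norm_eq]
    norm_num
  · intro j _ hj
    rw [real_inner_smul_right, ho.2 (fun h => hj (Fin.castLE_injective _ h).symm), mul_zero]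
  · simp

theorem inner_hemi_self (f : F.Frame) (i : Fin p) (x : Disc (EuclideanSpace ℝ (Fin i))) :
    inner ℝ (f.f i) (f.hemi i x) = √(1 - ‖(x : EuclideanSpace ℝ (Fin i))‖ ^ 2) := by
  have ho := f.orthonormal
  rw [hemi, inner_add_right, inner_sum, Finset.sum_eq_zero, real_inner_smul_right,
    real_inner_self_eq_norm_sq, f.norm_eq]
  · norm_num
  · intro k _
    rw [real_inner_smul_right, ho.2 (castLE_lt k).ne', mul_zero]

theorem phi_line_le_castSucc_iff (f : F.Frame) (i : Fin p)
    (x : Disc (EuclideanSpace ℝ (Fin i))) :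
    (f.phi i x).line.submodule ≤ F.V i.castSucc ↔ ‖(x : EuclideanSpace ℝ (Fin i))‖ = 1 := by
  have hx := mem_closedBall_zero_iff.1 x.2
  have hx0 := norm_nonneg (x : EuclideanSpace ℝ (Fin i))
  change (Projectivization.mk ℝ (f.hemi i x) (f.hemi_ne_zero i x)).submodule ≤ _ ↔ _
  rw [Projectivization.submodule_mk, Submodule.span_singleton_le_iff_mem, f.mem_V_castSucc_iff,
    inner_hemi_self, Real.sqrt_eq_zero (by nlinarith)]
  refine ⟨fun h => ?_, fun h => ⟨f.hemi_mem i x, by rw [h]; norm_num⟩⟩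
  nlinarith [h.2]

theorem isOpenCell_phi (f : F.Frame) (i : Fin p) (x : Disc (EuclideanSpace ℝ (Fin i)))
    (hx : ‖(x : EuclideanSpace ℝ (Fin i))‖ < 1) : F.IsOpenCell i (f.phi i x).line :=
  ⟨(f.phi i x).2, fun h => hx.ne ((f.phi_line_le_castSucc_iff i x).1 h)⟩

/-- Two unit vectors on one line differ by a scalar `a` with `a² = 1`; positive `f_i`-coordinates in
the open hemisphere force `a = 1`. -/
theorem phi_injective (f : F.Frame) (i : Fin p) (x y : Disc (EuclideanSpace ℝ (Fin i)))
    (hx : ‖(x : EuclideanSpace ℝ (Fin i))‖ < 1) (hy : ‖(y : EuclideanSpace ℝ (Fin i))‖ < 1)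
    (h : (f.phi i x).line = (f.phi i y).line) : x = y := by
  change Projectivization.mk ℝ (f.hemi i x) (f.hemi_ne_zero i x) =
    Projectivization.mk ℝ (f.hemi i y) (f.hemi_ne_zero i y) at h
  obtain ⟨a, ha⟩ := (Projectivization.mk_eq_mk_iff' ..).1 h
  have hpos : ∀ z : Disc (EuclideanSpace ℝ (Fin i)), ‖(z : EuclideanSpace ℝ (Fin i))‖ < 1 →
      0 < 1 - ‖(z : EuclideanSpace ℝ (Fin i))‖ ^ 2 := fun z hz => by
    nlinarith [norm_nonneg (z : EuclideanSpace ℝ (Fin i))]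
  have hxy : (x : EuclideanSpace ℝ (Fin i)) = a • (y : EuclideanSpace ℝ (Fin i)) := by
    ext k
    rw [PiLp.smul_apply, ← f.inner_hemi, ← f.inner_hemi, ← ha, real_inner_smul_right, smul_eq_mul]
  have hs := congrArg (inner ℝ (f.f i)) ha
  rw [real_inner_smul_right, inner_hemi_self, inner_hemi_self] at hs
  have hsx := Real.sqrt_pos.2 (hpos x hx)
  have hsy := Real.sqrt_pos.2 (hpos y hy)
  have hsx2 := Real.sq_sqrt (hpos x hx).le
  have hsy2 := Real.sq_sqrt (hpos y hy).le
  have ha0 : 0 < a := by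
    rw [← hs] at hsx
    exact pos_of_mul_pos_left hsx hsy.le
  have ha1 : a ^ 2 = 1 := by
    rw [← hs, mul_pow, hsy2, hxy, norm_smul, mul_pow, Real.norm_eq_abs, sq_abs] at hsx2
    linarith
  have ha2 : a = 1 := by nlinarith
  rw [ha2, one_smul] at hxy
  exact Subtype.ext hxy

/-- Every line has a unit vector with nonnegative `f_i`-coordinate; its other coordinates are the
required point of the disc. -/
theorem exists_phi (f : F.Frame) (i : Fin p) {ℓ : ℙ ℝ (EuclideanSpace ℝ (Fin p))}
    (h : ℓ.submodule ≤ F.V i.succ) : ∃ x, (f.phi i x).line = ℓ := by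
  obtain ⟨w, hw, hw0, hwV, hwi, rfl⟩ : ∃ (w : EuclideanSpace ℝ (Fin p)) (_ : ‖w‖ = 1) (hw : w ≠ 0)
      (_ : w ∈ F.V i.succ) (_ : 0 ≤ inner ℝ (f.f i) w), Projectivization.mk ℝ w hw = ℓ := by
    induction ℓ using Projectivization.ind with
    | h v hv =>
      rw [Projectivization.submodule_mk, Submodule.span_singleton_le_iff_mem] at h
      have hv' := norm_ne_zero_iff.2 hv
      obtain ⟨s, hs, hs'⟩ : ∃ s : ℝ, |s| = 1 ∧ 0 ≤ s * inner ℝ (f.f i) v := by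
        rcases le_total 0 (inner ℝ (f.f i) v) with h1 | h1
        · exact ⟨1, by simp, by simpa using h1⟩
        · exact ⟨-1, by simp, by simpa using h1⟩
      have hs0 : s ≠ 0 := by
        rintro rfl
        simp at hs
      refine ⟨(s / ‖v‖) • v, ?_, smul_ne_zero (div_ne_zero hs0 hv') hv,
        Submodule.smul_mem _ _ h, ?_, (Projectivization.mk_eq_mk_iff' ..).2 ⟨s / ‖v‖, rfl⟩⟩
      · rw [norm_smul, norm_div, norm_norm, Real.norm_eq_abs, hs, one_div, inv_mul_cancel₀ hv']
      · rw [real_inner_smul_right, div_mul_eq_mul_div]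
        exact div_nonneg hs' (norm_nonneg _)
  have hzero := (f.mem_V_succ_iff i w).1 hwV
  let x : EuclideanSpace ℝ (Fin i) :=
    WithLp.toLp 2 fun k => inner ℝ (f.f (Fin.castLE i.is_lt.le k)) w
  have hx : ‖x‖ ^ 2 + (inner ℝ (f.f i) w) ^ 2 = 1 := by
    have h1 := f.basis.sum_sq_norm_inner_right w
    simp only [basis_apply, Real.norm_eq_abs, sq_abs] at h1
    rw [hw, one_pow, sum_fin_eq i _ fun j hj => by rw [hzero j hj]; norm_num] at h1
    rw [EuclideanSpace.norm_sq_eq, ← h1]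
    simp [x]
  have hx1 : ‖x‖ ≤ 1 := by
    nlinarith [norm_nonneg x, sq_nonneg (inner ℝ (f.f i) w : ℝ)]
  refine ⟨⟨x, mem_closedBall_zero_iff.2 hx1⟩, ?_⟩
  have hhemi : f.hemi i ⟨x, mem_closedBall_zero_iff.2 hx1⟩ = w := by
    refine f.ext_inner fun j => ?_
    rcases lt_trichotomy j i with hj | rfl | hj
    · exact f.inner_hemi i _ ⟨j, hj⟩
    · rw [inner_hemi_self, show 1 - ‖x‖ ^ 2 = (inner ℝ (f.f j) w) ^ 2 by linarith,
        Real.sqrt_sq hwi]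
    · rw [hzero j hj]
      exact (f.mem_V_succ_iff i _).1 (f.hemi_mem i _) j hj
  change Projectivization.mk ℝ (f.hemi i _) _ = _
  simp only [hhemi]

theorem continuous_phi (f : F.Frame) (i : Fin p) : Continuous (f.phi i) := by
  refine Continuous.subtype_mk ?_ _
  have h : Continuous (f.hemi i) := by
    unfold hemi
    fun_prop
  exact continuous_quot_mk.comp (h.subtype_mk (f.hemi_ne_zero i))

/-- Stability of `V_{i+1}` kills the coordinates of `g f_i` beyond `i`. For `j < i`, `⟨f_j, g f_i⟩ =
⟨g f_j, f_i⟩ = 0` by stability of `V_{j+1}`. So `f_i` is an eigenvector, with eigenvalue `± 1`. -/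
theorem stdRep_f (f : F.Frame) (i : Fin p) (u : ℤˣ) :
    stdRep p q u (f.f i) = ((f.sign i u : ℤ) : ℝ) • f.f i := by
  have hinv : ∀ x, stdRep p q (-1) (stdRep p q (-1) x) = x := fun x => by
    have := congrArg (fun T : EuclideanSpace ℝ (Fin p) ≃ₗᵢ[ℝ] EuclideanSpace ℝ (Fin p) => T x)
      (map_mul (stdRep p q) (-1) (-1))
    simpa using this.symm
  have hmem := (f.mem_V_succ_iff i _).1 (F.stable _ (-1) _ (f.mem i))
  have heq : stdRep p q (-1) (f.f i) =
      (inner ℝ (f.f i) (stdRep p q (-1) (f.f i)) : ℝ) • f.f i := by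
    refine f.ext_inner fun j => ?_
    rw [real_inner_smul_right]
    rcases lt_trichotomy j i with hj | rfl | hj
    · rw [f.orthonormal.2 hj.ne, mul_zero, ← (stdRep p q (-1)).inner_map_map, hinv,
        real_inner_comm]
      exact (f.mem_V_succ_iff j _).1 (F.stable _ (-1) _ (f.mem j)) i hj
    · rw [real_inner_self_eq_norm_sq, f.norm_eq]
      norm_num
    · rw [f.orthonormal.2 hj.ne', mul_zero, hmem j hj]
  have hf0 : f.f i ≠ 0 := fun h0 => by simpa [h0] using f.norm_eq i
  rcases Int.units_eq_one_or u with rfl | rfl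
  · simp
  · unfold sign
    split_ifs with h
    · simpa using h
    · have hn := (stdRep p q (-1)).norm_map (f.f i)
      rw [heq, norm_smul, f.norm_eq, mul_one, Real.norm_eq_abs] at hn
      rcases eq_or_eq_neg_of_abs_eq hn with h1 | h1
      · rw [h1, one_smul] at heq
        exact absurd heq h
      · rw [h1] at heq
        rw [heq]
        simp

theorem phi_smul (f : F.Frame) (i : Fin p) (u : ℤˣ) (x y : Disc (EuclideanSpace ℝ (Fin i)))
    (h : ∀ k, (y : EuclideanSpace ℝ (Fin i)) k =
      (((f.sign (Fin.castLE i.is_lt.le k) * f.sign i) u : ℤ) : ℝ) *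
        (x : EuclideanSpace ℝ (Fin i)) k) :
    f.phi i y = u • f.phi i x := by
  have hsq : ∀ v : ℤˣ, ((v : ℤ) : ℝ) * ((v : ℤ) : ℝ) = 1 := fun v => by
    rcases Int.units_eq_one_or v with rfl | rfl <;> norm_num
  have hn : ‖(y : EuclideanSpace ℝ (Fin i))‖ = ‖(x : EuclideanSpace ℝ (Fin i))‖ := by
    simp only [EuclideanSpace.norm_eq]
    congr 1
    refine Finset.sum_congr rfl fun k _ => ?_
    rw [h]
    rcases Int.units_eq_one_or ((f.sign (Fin.castLE i.is_lt.le k) * f.sign i) u) with h1 | h1 <;>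
      rw [h1] <;> simp
  apply Subtype.ext
  change Projectivization.mk ℝ (f.hemi i y) _ =
    lineAct p q u (Projectivization.mk ℝ (f.hemi i x) (f.hemi_ne_zero i x))
  rw [lineAct_mk, Projectivization.mk_eq_mk_iff']
  -- The sign of `f_i` may be absorbed into the choice of spanning vector; it restores a nonnegative
  -- last coordinate and accounts for the second sign in each coordinate of `y`.
  refine ⟨((f.sign i u : ℤ) : ℝ), ?_⟩
  rw [hemi, hemi, hn, map_add, map_sum, smul_add, Finset.smul_sum]
  congr 1
  · refine Finset.sum_congr rfl fun k _ => ?_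
    rw [map_smul, f.stdRep_f, h, smul_smul, smul_smul]
    congr 1
    simp only [MonoidHom.mul_apply, Units.val_mul, Int.cast_mul]
    ring
  · rw [map_smul, f.stdRep_f, smul_smul, smul_smul]
    congr 1
    rw [mul_right_comm, hsq, one_mul]

end Flag.Frame

end cells


/-! ### Matrices of isometries -/

section matrices

variable {p q : ℕ}

theorem isoMat_mul (S T : EuclideanSpace ℝ (Fin p) ≃ₗᵢ[ℝ] EuclideanSpace ℝ (Fin p)) :
    isoMat (S * T) = isoMat S * isoMat T :=
  map_mul (LinearMap.toMatrixOrthonormal (EuclideanSpace.basisFun (Fin p) ℝ))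
    S.toLinearEquiv.toLinearMap T.toLinearEquiv.toLinearMap

theorem isoMat_one :
    isoMat (1 : EuclideanSpace ℝ (Fin p) ≃ₗᵢ[ℝ] EuclideanSpace ℝ (Fin p)) = 1 :=
  map_one (LinearMap.toMatrixOrthonormal (EuclideanSpace.basisFun (Fin p) ℝ))

theorem isoMat_injective : Function.Injective (isoMat (p := p)) := by
  intro S T h
  have h1 := (LinearMap.toMatrixOrthonormal (EuclideanSpace.basisFun (Fin p) ℝ)).injective h
  ext1 x
  exact LinearMap.congr_fun h1 x

theorem isoMat_apply (T : EuclideanSpace ℝ (Fin p) ≃ₗᵢ[ℝ] EuclideanSpace ℝ (Fin p))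
    (i j : Fin p) : isoMat T i j = T (EuclideanSpace.single j 1) i := by
  rw [isoMat, LinearMap.toMatrixOrthonormal_apply_apply, EuclideanSpace.basisFun_apply,
    EuclideanSpace.basisFun_apply, EuclideanSpace.inner_single_left]
  simp

theorem exists_isoMat (A : SO p q) :
    ∃ T : EuclideanSpace ℝ (Fin p) ≃ₗᵢ[ℝ] EuclideanSpace ℝ (Fin p),
      LinearMap.det T.toLinearEquiv.toLinearMap = 1 ∧ A.mat = isoMat T := by
  set e := LinearMap.toMatrixOrthonormal (EuclideanSpace.basisFun (Fin p) ℝ) with he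
  set M := e.symm A.mat with hM
  have hMA : e M = A.mat := e.apply_symm_apply _
  have hadj : star M * M = 1 := by
    have h : e (star M * M) = 1 := by
      rw [map_mul, map_star, hMA, Matrix.star_eq_conjTranspose,
        Matrix.conjTranspose_eq_transpose_of_trivial]
      exact mul_eq_one_comm.1 A.mat_mul_transpose
    exact e.injective (h.trans (map_one e).symm)
  let T : EuclideanSpace ℝ (Fin p) →ₗᵢ[ℝ] EuclideanSpace ℝ (Fin p) :=
    ⟨M, fun x => by
      have h1 : inner ℝ (M x) (M x) = (inner ℝ x x : ℝ) := by
        rw [← LinearMap.adjoint_inner_right]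
        exact congrArg (inner ℝ x) (LinearMap.congr_fun hadj x)
      rw [real_inner_self_eq_norm_sq, real_inner_self_eq_norm_sq] at h1
      exact (sq_eq_sq₀ (norm_nonneg _) (norm_nonneg _)).1 h1⟩
  have hT : (T.toLinearIsometryEquiv rfl).toLinearEquiv.toLinearMap = M := rfl
  refine ⟨T.toLinearIsometryEquiv rfl, ?_, ?_⟩
  · rw [hT, ← A.det_mat, ← hMA]
    exact (LinearMap.det_toMatrix (EuclideanSpace.basisFun (Fin p) ℝ).toBasis M).symm
  · rw [isoMat, hT, ← hMA]

instance : T2Space (SO p q) :=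
  inferInstanceAs (T2Space (Matrix.specialOrthogonalGroup (Fin p) ℝ))

instance : ContinuousMul (SO p q) :=
  inferInstanceAs (ContinuousMul (Matrix.specialOrthogonalGroup (Fin p) ℝ))

/-! ### The space of lines -/

theorem continuous_isoMat_refl :
    Continuous fun ℓ : ℙ ℝ (EuclideanSpace ℝ (Fin p)) => isoMat (refl ℓ) := by
  refine (isQuotientMap_quot_mk (X := {v : EuclideanSpace ℝ (Fin p) // v ≠ 0})).continuous_iff.2 ?_
  have h : ∀ v : {v : EuclideanSpace ℝ (Fin p) // v ≠ 0},
      isoMat (refl (Projectivization.mk ℝ v.1 v.2)) = isoMat (vecRefl v.1) := fun v => by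
    rw [refl_mk]
  change Continuous fun v : {v : EuclideanSpace ℝ (Fin p) // v ≠ 0} =>
    isoMat (refl (Projectivization.mk ℝ v.1 v.2))
  simp only [h]
  refine continuous_matrix fun i j => ?_
  simp only [isoMat_apply, vecRefl_apply, PiLp.sub_apply, PiLp.smul_apply, smul_eq_mul]
  refine continuous_const.sub (Continuous.mul (Continuous.div ?_ ?_ fun v => ?_) ?_)
  · fun_prop
  · fun_prop
  · simpa using v.2
  · fun_prop

theorem refl_injective : Function.Injective (refl (p := p)) := by
  intro ℓ ℓ' h
  induction ℓ using Projectivization.ind with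
  | h v hv =>
    induction ℓ' using Projectivization.ind with
    | h w hw =>
      rw [refl_mk, refl_mk] at h
      have hvv : inner ℝ v v ≠ (0 : ℝ) := by simpa using hv
      have h1 := congrArg
        (fun T : EuclideanSpace ℝ (Fin p) ≃ₗᵢ[ℝ] EuclideanSpace ℝ (Fin p) => T v) h
      simp only [vecRefl_apply, sub_right_inj] at h1
      rw [mul_div_assoc, div_self hvv, mul_one] at h1
      refine (Projectivization.mk_eq_mk_iff' ..).2
        ⟨(2 : ℝ)⁻¹ * (2 * inner ℝ w v / inner ℝ w w), ?_⟩
      rw [mul_smul, ← h1, inv_smul_smul₀ two_ne_zero]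

/-- The reflection embeds the lines continuously and injectively into matrices, so no separation
argument in the quotient is needed. -/
instance : T2Space (ℙ ℝ (EuclideanSpace ℝ (Fin p))) :=
  T2Space.of_injective_continuous (isoMat_injective.comp refl_injective) continuous_isoMat_refl

/-! ### The action on rotations -/

theorem stdRep_single (u : ℤˣ) (j : Fin p) :
    stdRep p q u (EuclideanSpace.single j 1) =
      ((coordSign p q j u : ℤ) : ℝ) • EuclideanSpace.single j 1 := by
  ext i
  change ((coordSign p q i u : ℤ) : ℝ) * _ = _
  by_cases h : i = j
  · subst h
    simp
  · simp [h]

theorem isoMat_stdRep : isoMat (stdRep p q (-1)) = Ipq p q := by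
  ext i j
  rw [isoMat_apply, stdRep_single, Ipq, Matrix.diagonal_apply]
  by_cases h : i = j
  · subst h
    by_cases h2 : (i : ℕ) < p - q <;> simp [coordSign, h2]
  · simp [h]

theorem stdRep_mul_self (u : ℤˣ) : stdRep p q u * stdRep p q u = 1 := by
  rw [← map_mul, Int.units_mul_self, map_one]

theorem stdRep_inv (u : ℤˣ) : (stdRep p q u)⁻¹ = stdRep p q u :=
  inv_eq_of_mul_eq_one_left (stdRep_mul_self u)

theorem mat_smul (u : ℤˣ) (A : SO p q) :
    (u • A).mat = isoMat (stdRep p q u) * A.mat * isoMat (stdRep p q u) := by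
  rcases Int.units_eq_one_or u with rfl | rfl
  · rw [map_one, isoMat_one, one_smul, one_mul, mul_one]
  · rw [isoMat_stdRep]
    rfl

theorem smul_mul (u : ℤˣ) (A B : SO p q) : u • (A * B) = (u • A) * (u • B) := by
  apply SO.mat_injective
  have h : isoMat (stdRep p q u) * isoMat (stdRep p q u) = 1 := by
    rw [← isoMat_mul, stdRep_mul_self, isoMat_one]
  rw [SO.mul_mat, mat_smul, mat_smul, mat_smul, SO.mul_mat]
  generalize isoMat (stdRep p q u) = R at *
  calc _ = R * A.mat * 1 * B.mat * R := by simp only [mul_assoc, one_mul]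
    _ = _ := by rw [← h]; simp only [mul_assoc]

theorem smul_one (u : ℤˣ) : u • (1 : SO p q) = 1 := by
  have h := smul_mul u (1 : SO p q) 1
  rw [mul_one] at h
  exact left_eq_mul.1 h

theorem refl_lineAct (u : ℤˣ) (ℓ : ℙ ℝ (EuclideanSpace ℝ (Fin p))) :
    refl (lineAct p q u ℓ) = stdRep p q u * refl ℓ * stdRep p q u := by
  induction ℓ using Projectivization.ind with
  | h v hv => rw [lineAct_mk, refl_mk, refl_mk, vecRefl_map, stdRep_inv]

variable [NeZero p]

theorem lineAct_lineE1 (u : ℤˣ) : lineAct p q u (lineE1 p) = lineE1 p := by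
  rw [lineE1, lineAct_mk, Projectivization.mk_eq_mk_iff']
  exact ⟨_, (stdRep_single u 0).symm⟩

theorem omegaLine_lineAct (u : ℤˣ) (ℓ : ℙ ℝ (EuclideanSpace ℝ (Fin p))) :
    omegaLine q (lineAct p q u ℓ) = u • omegaLine q ℓ := by
  apply SO.mat_injective
  rw [mat_smul]
  change isoMat (refl (lineAct p q u ℓ) * refl (lineE1 p)) =
    isoMat (stdRep p q u) * isoMat (refl ℓ * refl (lineE1 p)) * isoMat (stdRep p q u)
  rw [← isoMat_mul, ← isoMat_mul]
  congr 1
  -- Replacing the line of `e₁` by its equal image conjugates both reflections, and the inner signs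
  -- cancel.
  conv_lhs => rw [← lineAct_lineE1 (q := q) u]
  rw [refl_lineAct, refl_lineAct]
  have h := stdRep_mul_self (p := p) (q := q) u
  generalize stdRep p q u = R at *
  calc _ = R * refl ℓ * (R * R) * refl (lineE1 p) * R := by simp only [mul_assoc]
    _ = _ := by rw [h, mul_one, mul_assoc R]

theorem continuous_omegaLine : Continuous (omegaLine (p := p) q) := by
  refine Continuous.subtype_mk ?_ _
  simp only [isoMat_mul]
  exact continuous_isoMat_refl.matrix_mul continuous_const

variable {F : Flag p q}

theorem mat_prod_omegaLine (L : List (ℙ ℝ (EuclideanSpace ℝ (Fin p)))) :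
    (L.map (omegaLine q)).prod.mat = isoMat (rotProd L) := by
  induction L with
  | nil => exact isoMat_one.symm
  | cons ℓ L ih =>
    rw [List.map_cons, List.prod_cons, SO.mul_mat, ih]
    simp only [rotProd, List.map_cons, List.prod_cons]
    rw [isoMat_mul]
    rfl

theorem omega_mat (I : List (Fin p)) (v : F.PSeq I) :
    (omega F I v).mat = isoMat (rotProd (List.ofFn fun k => (v k).line)) := by
  rw [← mat_prod_omegaLine (q := q), List.map_ofFn]
  rfl

theorem omega_smul (I : List (Fin p)) (u : ℤˣ) (v : F.PSeq I) :
    omega F I (u • v) = u • omega F I v := by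
  have h : ∀ L : List (ℙ ℝ (EuclideanSpace ℝ (Fin p))),
      (L.map fun ℓ => omegaLine q (lineAct p q u ℓ)).prod = u • (L.map (omegaLine q)).prod := by
    intro L
    induction L with
    | nil => exact (smul_one u).symm
    | cons ℓ L ih =>
      rw [List.map_cons, List.map_cons, List.prod_cons, List.prod_cons, smul_mul, ih,
        omegaLine_lineAct]
  have h1 := h (List.ofFn fun k => (v k).line)
  rw [List.map_ofFn, List.map_ofFn] at h1
  exact h1

theorem continuous_line (i : Fin p) : Continuous (Flag.P.line (F := F) (i := i)) :=
  continuous_subtype_val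

theorem continuous_omega (I : List (Fin p)) : Continuous (omega F I) := by
  unfold omega
  simp only [List.ofFn_eq_map]
  exact continuous_list_prod _ fun k _ =>
    continuous_omegaLine.comp ((continuous_line _).comp (continuous_apply k))

instance (i : Fin p) : T2Space (F.P i) :=
  inferInstanceAs (T2Space
    {ℓ : ℙ ℝ (EuclideanSpace ℝ (Fin p)) // ℓ.submodule ≤ F.V i.succ})

end matrices

/-! ### Discs of the cell representations -/

section discs

open RepCell Flag.Frame

variable {p q m : ℕ} (a : Fin m → Fin p)

theorem finrank_cellSpace : Module.finrank ℝ (CellSpace a) = ∑ k, (a k : ℕ) := by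
  simp [finrank_euclideanSpace, Fintype.card_sigma]

theorem norm_radialHomeo {E E' : Type*} [NormedAddCommGroup E] [NormedSpace ℝ E]
    [FiniteDimensional ℝ E] [NormedAddCommGroup E'] [NormedSpace ℝ E'] (L : E ≃L[ℝ] E')
    (x : closedBall (0 : E) 1) : ‖(radialHomeo L x : E')‖ = ‖(x : E)‖ := by
  change ‖(‖(x : E)‖ / ‖L x‖) • L x‖ = ‖(x : E)‖
  by_cases hx : (x : E) = 0
  · simp [hx]
  · have : ‖L x‖ ≠ 0 := by simpa using hx
    rw [norm_smul, norm_div, norm_norm, norm_norm, div_mul_cancel₀ _ this]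

theorem norm_discHomeo_lt {x : Disc (CellSpace a)} (hx : ‖(x : CellSpace a)‖ < 1) (k : Fin m) :
    ‖(discHomeo a x k : EuclideanSpace ℝ (Fin (a k)))‖ < 1 := by
  rw [← norm_radialHomeo (splitEquiv a)] at hx
  exact (norm_le_pi_norm _ k).trans_lt hx

theorem exists_norm_discHomeo_eq {x : Disc (CellSpace a)} (hx : ‖(x : CellSpace a)‖ = 1) :
    ∃ k, ‖(discHomeo a x k : EuclideanSpace ℝ (Fin (a k)))‖ = 1 := by
  by_contra! h
  rw [← norm_radialHomeo (splitEquiv a)] at hx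
  refine hx.not_lt ((pi_norm_lt_iff one_pos).2 fun k => ?_)
  exact lt_of_le_of_ne (mem_closedBall_zero_iff.1 (discHomeo a x k).2) (h k)

/-- Sign changes preserve both the Euclidean and the maximum norm, hence the radial scaling factor.
-/
theorem discHomeo_discAct [NeZero p] {F : Flag p q} (f : F.Frame) (u : ℤˣ) (x : Disc (CellSpace a)) (k : Fin m)
    (j : Fin (a k)) :
    (discHomeo a (discAct (f.cellRep a) u x) k : EuclideanSpace ℝ (Fin (a k))) j =
      (((f.sign (Fin.castLE (a k).is_lt.le j) * f.sign (a k)) u : ℤ) : ℝ) *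
        (discHomeo a x k : EuclideanSpace ℝ (Fin (a k))) j := by
  have hn : ‖splitEquiv a (f.cellRep a u x)‖ = ‖splitEquiv a x‖ := by
    rw [Pi.norm_def, Pi.norm_def]
    congr 2
    funext k
    apply NNReal.eq
    change ‖splitEquiv a (f.cellRep a u x) k‖ = ‖splitEquiv a x k‖
    simp only [EuclideanSpace.norm_eq]
    congr 1
    refine Finset.sum_congr rfl fun j _ => ?_
    change ‖(((f.sign (Fin.castLE (a k).is_lt.le j) * f.sign (a k)) u : ℤ) : ℝ) *
      (x : CellSpace a) ⟨k, j⟩‖ ^ 2 = ‖(x : CellSpace a) ⟨k, j⟩‖ ^ 2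
    rcases Int.units_eq_one_or ((f.sign (Fin.castLE (a k).is_lt.le j) * f.sign (a k)) u)
      with h1 | h1 <;> rw [h1] <;> simp
  change (‖f.cellRep a u x‖ / ‖splitEquiv a (f.cellRep a u x)‖) *
      ((((f.sign (Fin.castLE (a k).is_lt.le j) * f.sign (a k)) u : ℤ) : ℝ) *
        (x : CellSpace a) ⟨k, j⟩) =
    (((f.sign (Fin.castLE (a k).is_lt.le j) * f.sign (a k)) u : ℤ) : ℝ) *
      ((‖(x : CellSpace a)‖ / ‖splitEquiv a x‖) * (x : CellSpace a) ⟨k, j⟩)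
  rw [hn, (f.cellRep a u).norm_map]
  ring

end discs


/-! ### Boundaries of product cells and the two complexes -/

section complexes

open RepCell Flag.Frame

open scoped Pointwise

/-- If `ℝⁱ` contains a unit vector, then `i` has a predecessor. -/
theorem exists_pred {p : ℕ} {i : Fin p} {x : EuclideanSpace ℝ (Fin i)} (hx : ‖x‖ = 1) :
    ∃ k : Fin p, (i : ℕ) = k + 1 ∧ k.succ = i.castSucc := by
  obtain ⟨n, hn⟩ := i
  cases n with
  | zero =>
    exfalso
    rw [EuclideanSpace.norm_eq] at hx
    simp at hx
  | succ n => exact ⟨⟨n, by omega⟩, rfl, rfl⟩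

theorem sum_update_lt {p m : ℕ} (a : Fin m → Fin p) (k : Fin m) (i : Fin p)
    (h : (a k : ℕ) = i + 1) : ∑ l, (Function.update a k i l : ℕ) < ∑ l, (a l : ℕ) := by
  refine Finset.sum_lt_sum (fun l _ => ?_) ⟨k, Finset.mem_univ k, by simp [h]⟩
  by_cases hl : l = k
  · subst hl
    simp [h]
  · simp [hl]

variable {p q : ℕ} [NeZero p] {F : Flag p q}

/-! ### The product of projective spaces -/

namespace Flag.Frame

theorem exists_phiSub (f : F.Frame) (I : List (Fin p))
    (J : ∀ k : Fin I.length, {j : Fin p // j ≤ I.get k}) (v : F.PSeq I)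
    (hv : ∀ k, (v k).line.submodule ≤ F.V (J k).1.succ) : ∃ x, f.phiSub I J x = v := by
  choose x hx using fun k => f.exists_phi (J k).1 (hv k)
  exact ⟨x, funext fun k => Subtype.ext (hx k)⟩

theorem continuous_phiSub (f : F.Frame) (I : List (Fin p))
    (J : ∀ k : Fin I.length, {j : Fin p // j ≤ I.get k}) : Continuous (f.phiSub I J) :=
  continuous_pi fun k => Continuous.subtype_mk
    ((continuous_line _).comp ((f.continuous_phi _).comp (continuous_apply k))) _

theorem continuous_phiSeq (f : F.Frame) (I : List (Fin p)) : Continuous (f.phiSeq I) :=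
  continuous_pi fun k => (f.continuous_phi _).comp (continuous_apply k)

/-- If a point of a product of cells lies on the boundary, then one of its lines lies in a
projective space of lower dimension. -/
theorem exists_update (f : F.Frame) {m : ℕ} (a : Fin m → Fin p) (x : Disc (CellSpace a))
    (hx : ‖(x : CellSpace a)‖ = 1) :
    ∃ b : Fin m → Fin p, (∀ k, b k ≤ a k) ∧ ∑ k, (b k : ℕ) < ∑ k, (a k : ℕ) ∧
      ∀ k, (f.phi (a k) (discHomeo a x k)).line.submodule ≤ F.V (b k).succ := by
  obtain ⟨k, hk⟩ := exists_norm_discHomeo_eq a hx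
  obtain ⟨i, hi, hi'⟩ := exists_pred hk
  refine ⟨Function.update a k i, fun l => ?_, sum_update_lt a k i hi, fun l => ?_⟩
  · by_cases hl : l = k
    · subst hl
      rw [Function.update_self, Fin.le_def]
      omega
    · rw [Function.update_of_ne hl]
  · by_cases hl : l = k
    · subst hl
      rw [Function.update_self, hi']
      exact (f.phi_line_le_castSucc_iff _ _).2 hk
    · rw [Function.update_of_ne hl]
      exact (f.phi _ _).2

theorem areCharMaps_phiSub (f : F.Frame) (I : List (Fin p)) :
    AreCharMaps (G := ℤˣ) (ι := ∀ k : Fin I.length, {j : Fin p // j ≤ I.get k})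
      (V := fun J => CellSpace fun k => (J k).1)
      (fun J => f.cellRep fun k => (J k).1)
      (fun J => f.phiSub I J ∘ discHomeo fun k => (J k).1)
      (skeleton fun J => f.phiSub I J ∘ discHomeo fun k => (J k).1) := by
  apply areCharMaps_skeleton
  · exact fun J => (f.continuous_phiSub I J).comp (discHomeo _).continuous
  · intro J u x
    funext k
    apply Subtype.ext
    have h := congrArg Flag.P.line (f.phi_smul (J k).1 u _ _ fun j =>
      discHomeo_discAct (fun k => (J k).1) f u x k j)
    exact h
  · intro J x hx
    obtain ⟨b, hb, hlt, hle⟩ := f.exists_update (fun k => (J k).1) x hx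
    obtain ⟨y, hy⟩ := f.exists_phiSub I (fun k => ⟨b k, (hb k).trans (J k).2⟩)
      (f.phiSub I J (discHomeo _ x)) hle
    refine ⟨fun k => ⟨b k, (hb k).trans (J k).2⟩, ?_, (discHomeo _).symm y, ?_⟩
    · rw [finrank_cellSpace, finrank_cellSpace]
      exact hlt
    · rw [Function.comp_apply, Homeomorph.apply_symm_apply, hy, Function.comp_apply]
  · intro J J' x y hx hy h
    have hline : ∀ k, (f.phi (J k).1 (discHomeo _ x k)).line =
        (f.phi (J' k).1 (discHomeo _ y k)).line := fun k =>
      congrArg Flag.P.line (congrFun h k)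
    have hx' := norm_discHomeo_lt _ hx
    have hy' := norm_discHomeo_lt _ hy
    have hJ : J = J' := by
      funext k
      refine Subtype.ext ((f.isOpenCell_phi _ _ (hx' k)).unique (j := (J' k).1) ?_)
      rw [hline k]
      exact f.isOpenCell_phi _ _ (hy' k)
    subst hJ
    rw [(discHomeo _).injective
      (funext fun k => f.phi_injective _ _ _ (hx' k) (hy' k) (hline k))]
  · intro v
    obtain ⟨x, hx⟩ := f.exists_phiSub I (fun k => ⟨I.get k, le_rfl⟩) v fun k => (v k).2
    exact ⟨_, (discHomeo _).symm x, by
      rw [Function.comp_apply, Homeomorph.apply_symm_apply, hx]⟩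

/-! ### The rotation group -/

theorem rotProd_mem_word {m : ℕ} (a : Fin m → Fin p)
    (ℓ : Fin m → ℙ ℝ (EuclideanSpace ℝ (Fin p))) (h : ∀ k, (ℓ k).submodule ≤ F.V (a k).succ) :
    rotProd (List.ofFn ℓ) ∈ F.word (List.ofFn a) := by
  rw [Flag.word, List.map_ofFn, Set.mem_prod_list_ofFn]
  refine ⟨fun k => ⟨refl (ℓ k) * refl (lineE1 p), ?_⟩, ?_⟩
  · have hk := h k
    revert hk
    induction ℓ k using Projectivization.ind with
    | h v hv =>
      intro hk
      rw [Projectivization.submodule_mk, Submodule.span_singleton_le_iff_mem] at hk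
      exact ⟨v, hk, hv, by rw [refl_mk, refl_lineE1]⟩
  · rw [rotProd, List.map_ofFn]
    rfl

theorem exists_phiSeq (f : F.Frame) (I : List (Fin p)) {A : SO p q}
    {T : EuclideanSpace ℝ (Fin p) ≃ₗᵢ[ℝ] EuclideanSpace ℝ (Fin p)} (hA : A.mat = isoMat T)
    (hT : T ∈ F.word I) : ∃ x, omega F I (f.phiSeq I x) = A := by
  have hI : F.word I = (List.ofFn fun k => F.rot (I.get k)).prod := by
    conv_lhs => rw [← List.ofFn_get I, Flag.word, List.map_ofFn]
    rfl
  rw [hI, Set.mem_prod_list_ofFn] at hT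
  obtain ⟨g, hg⟩ := hT
  choose v hv hv0 hvg using fun k => (g k).2
  choose x hx using fun k => f.exists_phi (I.get k) (ℓ := Projectivization.mk ℝ (v k) (hv0 k)) (by
    rw [Projectivization.submodule_mk, Submodule.span_singleton_le_iff_mem]
    exact hv k)
  refine ⟨x, SO.mat_injective ?_⟩
  rw [hA, omega_mat, ← hg, rotProd, List.map_ofFn]
  congr 3
  funext k
  change refl (f.phi (I.get k) (x k)).line * _ = _
  rw [hx, refl_mk, refl_lineE1, hvg]

/-- The characteristic map of the cell of `SO(p,q)` with index `I`. -/
noncomputable def cellMap (f : F.Frame) (I : {I : List (Fin p) // Admissible I}) :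
    Disc (CellSpace I.1.get) → SO p q :=
  omega F I.1 ∘ f.phiSeq I.1 ∘ discHomeo I.1.get

/-- This is where the reduction to admissible sequences becomes a statement on cells; boundary,
covering and cellularity all rest on it. -/
theorem exists_cellMap (f : F.Frame) (I : List (Fin p)) {A : SO p q}
    {T : EuclideanSpace ℝ (Fin p) ≃ₗᵢ[ℝ] EuclideanSpace ℝ (Fin p)} (hA : A.mat = isoMat T)
    (hT : T ∈ F.word I) : ∃ J : {J : List (Fin p) // Admissible J},
      Module.finrank ℝ (CellSpace J.1.get) ≤ (I.map Fin.val).sum ∧ A ∈ range (f.cellMap J) := by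
  obtain ⟨J, hJ, hsum, hTJ⟩ := F.exists_admissible f I hT
  obtain ⟨x, hx⟩ := f.exists_phiSeq J hA hTJ
  refine ⟨⟨J, hJ⟩, ?_, (discHomeo _).symm x, ?_⟩
  · rw [finrank_cellSpace]
    refine le_trans (le_of_eq ?_) hsum
    conv_rhs => rw [← List.ofFn_get J, List.map_ofFn, List.sum_ofFn]
    rfl
  · rw [cellMap, Function.comp_apply, Function.comp_apply, Homeomorph.apply_symm_apply, hx]

theorem exists_cellMap_of_lines (f : F.Frame) {m : ℕ} (a : Fin m → Fin p)
    (ℓ : Fin m → ℙ ℝ (EuclideanSpace ℝ (Fin p))) (h : ∀ k, (ℓ k).submodule ≤ F.V (a k).succ)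
    {A : SO p q} (hA : A.mat = isoMat (rotProd (List.ofFn ℓ))) :
    ∃ J : {J : List (Fin p) // Admissible J},
      Module.finrank ℝ (CellSpace J.1.get) ≤ ∑ k, (a k : ℕ) ∧ A ∈ range (f.cellMap J) := by
  obtain ⟨J, hJ, hAJ⟩ := f.exists_cellMap (List.ofFn a) hA (rotProd_mem_word a ℓ h)
  refine ⟨J, hJ.trans (le_of_eq ?_), hAJ⟩
  rw [List.map_ofFn, List.sum_ofFn]
  rfl

/-- The cell `(0)` has a nonpositive index, so `rotProd_injective` does not cover it. Its product is
the identity, and it is compared through the empty sequence instead. -/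
theorem admissible_eq (f : F.Frame) {I I' : List (Fin p)}
    {L L' : List (ℙ ℝ (EuclideanSpace ℝ (Fin p)))} (hI : Admissible I) (hI' : Admissible I')
    (h : List.Forall₂ F.IsOpenCell I L) (h' : List.Forall₂ F.IsOpenCell I' L')
    (heq : rotProd L = rotProd L') : I = I' ∧ (I ≠ [0] → L = L') := by
  have hzero : ∀ L, List.Forall₂ F.IsOpenCell [0] L → rotProd L = rotProd [] := by
    intro L hL
    cases hL with
    | @cons _ ℓ _ _ hi hL =>
      cases hL
      have h1 := rotProd_mem_word (F := F) (fun _ : Fin 1 => 0) (fun _ => ℓ) fun _ => hi.1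
      simp only [List.ofFn_succ, List.ofFn_zero, Flag.word_cons, Flag.rot_zero, one_mul,
        Flag.word_nil, Set.mem_one] at h1
      exact h1
  rcases hI with rfl | ⟨hn, hI, h0⟩ <;> rcases hI' with rfl | ⟨hn', hI', h0'⟩
  · exact ⟨rfl, fun h => absurd rfl h⟩
  · rw [hzero L h] at heq
    exact absurd (f.rotProd_injective .nil hI' (by simp) h0' .nil h' heq).1.symm hn'
  · rw [hzero L' h'] at heq
    exact absurd (f.rotProd_injective hI .nil h0 (by simp) h .nil heq).1 hn
  · have h1 := f.rotProd_injective hI hI' h0 h0' h h' heq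
    exact ⟨h1.1, fun _ => h1.2⟩

instance finite_admissible : Finite {I : List (Fin p) // Admissible I} := by
  have h : ∀ I : {I : List (Fin p) // Admissible I}, I.1.Nodup := by
    rintro ⟨I, rfl | ⟨-, hI, -⟩⟩
    · simp
    · exact hI.imp fun h => h.ne'
  exact Finite.of_injective (β := {I : List (Fin p) // I.Nodup}) (fun I => ⟨I.1, h I⟩)
    fun I J hIJ => Subtype.ext (congrArg (fun K => K.1) hIJ)

theorem forall₂_ofFn {α β : Type*} {R : α → β → Prop} (I : List α) (g : Fin I.length → β)
    (h : ∀ k, R (I.get k) (g k)) : List.Forall₂ R I (List.ofFn g) := by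
  rw [List.forall₂_iff_get]
  refine ⟨by simp, fun k hk hk' => ?_⟩
  simpa using h ⟨k, hk⟩

theorem areCharMaps_cellMap (f : F.Frame) :
    AreCharMaps (G := ℤˣ) (V := fun I : {I : List (Fin p) // Admissible I} => CellSpace I.1.get)
      (fun I => f.cellRep I.1.get) f.cellMap (skeleton f.cellMap) := by
  apply areCharMaps_skeleton
  · exact fun I => (continuous_omega I.1).comp
      ((f.continuous_phiSeq I.1).comp (discHomeo _).continuous)
  · intro I u x
    simp only [cellMap, Function.comp_apply]
    rw [← omega_smul]
    congr 1
    funext k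
    exact f.phi_smul (I.1.get k) u _ _ fun j => discHomeo_discAct _ f u x k j
  · intro I x hx
    -- The sequence `b` need not be admissible, but the reduction cannot undo the strict drop in
    -- total dimension.
    obtain ⟨b, -, hlt, hle⟩ := f.exists_update I.1.get x hx
    obtain ⟨J, hJ, hAJ⟩ := f.exists_cellMap_of_lines b _ hle (A := f.cellMap I x)
      (omega_mat I.1 _)
    refine ⟨J, hJ.trans_lt ?_, hAJ⟩
    rw [finrank_cellSpace]
    exact hlt
  · rintro ⟨I, hI⟩ ⟨I', hI'⟩ x y hx hy h
    have hx' := norm_discHomeo_lt _ hx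
    have hy' := norm_discHomeo_lt _ hy
    have hrot := congrArg SO.mat h
    simp only [cellMap, Function.comp_apply] at hrot
    rw [omega_mat, omega_mat] at hrot
    obtain ⟨hII, hL⟩ := f.admissible_eq hI hI'
      (forall₂_ofFn I _ fun k => f.isOpenCell_phi _ _ (hx' k))
      (forall₂_ofFn I' _ fun k => f.isOpenCell_phi _ _ (hy' k)) (isoMat_injective hrot)
    subst hII
    suffices hxy : x = y by rw [hxy]
    by_cases h0 : I = [0]
    · subst h0
      -- The disc of the cell `(0)` is a point, since its coordinates are indexed by an empty type.
      refine Subtype.ext (PiLp.ext fun z => ?_)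
      have hz := z.2.is_lt
      simp at hz
    · have hline := List.ofFn_injective (hL h0)
      exact (discHomeo _).injective
        (funext fun k => f.phi_injective _ _ _ (hx' k) (hy' k) (congrFun hline k))
  · intro A
    obtain ⟨T, hdet, hA⟩ := exists_isoMat A
    obtain ⟨I, hT⟩ := F.exists_word f hdet
    obtain ⟨J, -, hJ⟩ := f.exists_cellMap I hA hT
    exact ⟨J, hJ⟩

theorem isCellular_omega (f : F.Frame) (I : List (Fin p)) :
    IsCellular ℤˣ (skeleton fun J : ∀ k : Fin I.length, {j : Fin p // j ≤ I.get k} =>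
        f.phiSub I J ∘ discHomeo fun k => (J k).1)
      (skeleton f.cellMap) (omega F I) where
  continuous := continuous_omega I
  equivariant u v := omega_smul I u v
  mapsTo := by
    rintro n _ ⟨J, hJ, x, rfl⟩
    rw [finrank_cellSpace] at hJ
    have hmat := omega_mat I (f.phiSub I J (discHomeo (fun k => (J k).1) x))
    obtain ⟨K, hK, hA⟩ := f.exists_cellMap_of_lines (fun k => (J k).1)
      (fun k => (f.phi (J k).1 (discHomeo (fun k => (J k).1) x k)).line)
      (fun k => (f.phi (J k).1 (discHomeo (fun k => (J k).1) x k)).2) hmat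
    exact ⟨K, hK.trans hJ, hA⟩

end Flag.Frame

end complexes

end Rot

theorem proposition2 (p q : ℕ) [NeZero p] (hqp : q ≤ p) (F : Rot.Flag p q) (f : F.Frame) :
    ∃ (skSO : ℕ → Set (Rot.SO p q)) (skP : ℕ → Set (F.PSeq (Rot.topSeq p))),
      RepCell.AreCharMaps (G := ℤˣ) (ι := {I : List (Fin p) // Rot.Admissible I})
        (V := fun I => Rot.Flag.Frame.CellSpace I.1.get)
        (fun I => f.cellRep I.1.get)
        (fun I => Rot.omega F I.1 ∘ f.phiSeq I.1 ∘ Rot.Flag.Frame.discHomeo I.1.get)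
        skSO ∧
      RepCell.AreCharMaps (G := ℤˣ)
        (ι := ∀ k : Fin (Rot.topSeq p).length, {j : Fin p // j ≤ (Rot.topSeq p).get k})
        (V := fun J => Rot.Flag.Frame.CellSpace fun k => (J k).1)
        (fun J => f.cellRep fun k => (J k).1)
        (fun J => f.phiSub (Rot.topSeq p) J ∘ Rot.Flag.Frame.discHomeo fun k => (J k).1)
        skP ∧
      RepCell.IsCellular ℤˣ skP skSO (Rot.omega F (Rot.topSeq p)) :=
  ⟨_, _, f.areCharMaps_cellMap, f.areCharMaps_phiSub _, f.isCellular_omega _⟩
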